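/- Let $n \geq 1$ be an integer. For an irrational real number $\xi$, define its $n$-approximability \[ \lambda_n(\xi) = \limsup_{\frac{s}{t} \in \mathbb{Q},\ \frac{s}{t} \to \xi} \frac{\gcd(t,n)}{t^2 \left|\frac{s}{t} - \xi\right|} \in \mathbb{R} \cup \{\infty\}, \] where $s/t$ runs over rational numbers written in lowest terms with $t > 0$. Let \[ \mathcal{L}_n = \{\lambda_n(\xi) : \xi \in \mathbb{R} \setminus \mathbb{Q},\ \lambda_n(\xi) < \infty\} \subseteq \mathbb{R} \] be the $n$-Lagrange spectrum, and let $\mathcal{P}_n \subseteq \mathcal{L}_n$ be the set of real values $\lambda_n(\xi)$ attained at quadratic irrationals $\xi$, that is, at irrational real roots of quadratic polynomials with integer coefficients. Then $\mathcal{L}_n$ is a closed subset of $\mathbb{R}$. More strongly, $\mathcal{L}_n$ is the closure of $\mathcal{P}_n$ in $\mathbb{R}$. -/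

import Mathlib

open Filter Topology

noncomputable section

/-- The `n`-quality `gcd(t, n) / (t² |s/t - ξ|)` of a rational approximation `q = s/t`
(in lowest terms) to a real number `ξ`. -/
def nQuality (n : ℕ) (ξ : ℝ) (q : ℚ) : ℝ :=
  (Nat.gcd q.den n : ℝ) / ((q.den : ℝ) ^ 2 * |(q : ℝ) - ξ|)

/-- The `n`-approximability `λ_n(ξ)`: the limsup of the `n`-qualities of the rationals `s/t`
as `s/t → ξ`, with values in the extended reals (it may be `∞`). -/
def nApproximability (n : ℕ) (ξ : ℝ) : EReal :=
  limsup (fun q : ℚ => (nQuality n ξ q : EReal)) (comap (fun q : ℚ => (q : ℝ)) (𝓝[≠] ξ))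

/-- The `n`-Lagrange spectrum: the set of real (finite) values of `λ_n` at irrational numbers. -/
def nLagrangeSpectrum (n : ℕ) : Set ℝ :=
  {α : ℝ | ∃ ξ : ℝ, Irrational ξ ∧ nApproximability n ξ = (α : EReal)}

/-- Quadratic irrationals: irrational real roots of quadratic polynomials with integer
coefficients. -/
def IsQuadraticIrrational (ξ : ℝ) : Prop :=
  Irrational ξ ∧ ∃ a b c : ℤ, a ≠ 0 ∧ (a : ℝ) * ξ ^ 2 + (b : ℝ) * ξ + (c : ℝ) = 0

/-- The set of `n`-approximabilities of quadratic irrationals. -/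
def quadraticApproximabilities (n : ℕ) : Set ℝ :=
  {α : ℝ | ∃ ξ : ℝ, IsQuadraticIrrational ξ ∧ nApproximability n ξ = (α : EReal)}

end

/-! Code an irrational number with partial quotients at most `K` by a sequence of letters: its
partial quotients, each with the reduction modulo `n` of the product of the preceding step matrices.
Extend the sequence to negative indices. The two continued fractions read off its halves are the
roots `ξ, η` of an indefinite binary quadratic form of discriminant `1`. If the absolute value of
the form replaces `t² |s/t - ξ|` in the quality of `s/t`, then the quality changes by a factor that
tends to `1` as `s/t → ξ`, and it becomes invariant under `GL₂(ℤ)` as long as `gcd(t, n)` is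
followed along, which is what the residues are for. After a change of basis a good approximation is
a vector in a fixed finite box, so `λ_n(ξ)` is the upper limit, along the orbit of the coding
sequence under the shift, of a continuous function on the paths of a finite directed graph.

The upper limits of a continuous function along the paths of such a graph form the closure of those
along periodic paths. A path comes back to a window of its upper limit and can be closed up there;
conversely, if the upper limits along periodic paths converge, then a subsequence of these paths
converges, and its members, each repeated often enough, can be concatenated. Periodic paths
correspond to quadratic irrationals, the irrational fixed points of elements of `GL₂(ℤ)` other than
`1` and `-1`. -/

section Limsup

variable {ι κ : Type*} {l : Filter ι} {l' : Filter κ} {u : ι → ℝ} {v : κ → ℝ}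

theorem limsup_coe_le_limsup_coe
    (h : ∀ b b' : ℝ, b < b' → (∀ᶠ k in l', v k ≤ b) → ∀ᶠ i in l, u i ≤ b') :
    limsup (fun i => (u i : EReal)) l ≤ limsup (fun k => (v k : EReal)) l' := by
  refine EReal.le_of_forall_lt_iff_le.1 fun b' hb' => ?_
  obtain ⟨b, hvb, hbb'⟩ := EReal.lt_iff_exists_real_btwn.1 hb'
  have hv : ∀ᶠ k in l', v k ≤ b :=
    (eventually_lt_of_limsup_lt hvb).mono fun k hk => EReal.coe_le_coe_iff.1 hk.le
  exact limsup_le_of_le (by isBoundedDefault)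
    ((h b b' (EReal.coe_lt_coe_iff.1 hbb') hv).mono fun i hi => EReal.coe_le_coe_iff.2 hi)

theorem limsup_coe_eq_coe_iff {a : ℝ} :
    limsup (fun i => (u i : EReal)) l = a ↔
      ∀ ε > 0, (∀ᶠ i in l, u i ≤ a + ε) ∧ ∃ᶠ i in l, a - ε ≤ u i := by
  refine ⟨fun h ε hε => ⟨?_, ?_⟩, fun h => le_antisymm ?_ ?_⟩
  · have hlt : limsup (fun i => (u i : EReal)) l < (a + ε : ℝ) :=
      h ▸ EReal.coe_lt_coe_iff.2 (lt_add_of_pos_right a hε)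
    exact (eventually_lt_of_limsup_lt hlt).mono fun i hi => EReal.coe_le_coe_iff.1 hi.le
  · have hlt : (a - ε : ℝ) < limsup (fun i => (u i : EReal)) l :=
      h ▸ EReal.coe_lt_coe_iff.2 (sub_lt_self a hε)
    exact (frequently_lt_of_lt_limsup (by isBoundedDefault) hlt).mono
      fun i hi => EReal.coe_le_coe_iff.1 hi.le
  · refine EReal.le_of_forall_lt_iff_le.1 fun b hb => ?_
    have hab : 0 < b - a := sub_pos.2 (EReal.coe_lt_coe_iff.1 hb)
    refine limsup_le_of_le (by isBoundedDefault) ((h _ hab).1.mono fun i hi => ?_)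
    exact EReal.coe_le_coe_iff.2 (by linarith)
  · refine EReal.ge_of_forall_gt_iff_ge.1 fun b hb => ?_
    have hba : 0 < a - b := sub_pos.2 (EReal.coe_lt_coe_iff.1 hb)
    refine le_limsup_of_frequently_le ((h _ hba).2.mono fun i hi => ?_) (by isBoundedDefault)
    exact EReal.coe_le_coe_iff.2 (by linarith)

end Limsup

noncomputable section SymbolicDynamics

open Set Function SymbolicDynamics.FullShift

variable {A : Type*} {T : A → A → Prop} {F : (ℤ → A) → ℝ} {x : ℤ → A} {p : ℤ}

/-- Two-sided sequences whose nonnegative half is an infinite path in the directed graph `T`. The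
negative half is unconstrained. -/
def IsPath (T : A → A → Prop) (x : ℤ → A) : Prop := ∀ k : ℕ, T (x k) (x (k + 1))

/-- The upper limit of an observable `F` along the forward orbit of `x` under the shift. -/
def orbitLimsup (F : (ℤ → A) → ℝ) (x : ℤ → A) : EReal :=
  limsup (fun k : ℕ => (F (shift (k : ℤ) x) : EReal)) atTop

/-- The dynamical spectrum of `F` on the paths of `T`: the real upper limits along orbits. -/
def pathSpectrum (T : A → A → Prop) (F : (ℤ → A) → ℝ) : Set ℝ :=
  {a | ∃ x, IsPath T x ∧ orbitLimsup F x = a}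

/-- The part of `pathSpectrum T F` that comes from periodic paths. -/
def periodicSpectrum (T : A → A → Prop) (F : (ℤ → A) → ℝ) : Set ℝ :=
  {a | ∃ x, (∃ p : ℤ, 0 < p ∧ Periodic x p) ∧ IsPath T x ∧ orbitLimsup F x = a}

theorem exists_window_of_continuous [Finite A] [TopologicalSpace A] [DiscreteTopology A]
    (hF : Continuous F) {ε : ℝ} (hε : 0 < ε) :
    ∃ N : ℕ, ∀ x y, EqOn x y (Icc (-N : ℤ) N) → |F x - F y| ≤ ε := by
  obtain rfl : ‹TopologicalSpace A› = ⊥ := DiscreteTopology.eq_bot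
  let _ : UniformSpace A := ⊥
  have hsmall : {q : ℝ × ℝ | dist q.1 q.2 < ε} ∈ uniformity ℝ := Metric.dist_mem_uniformity hε
  have hunif := CompactSpace.uniformContinuous_of_continuous hF hsmall
  rw [mem_map, Pi.uniformity] at hunif
  simp only [DiscreteUniformity.eq_principal_setRelId, comap_principal] at hunif
  obtain ⟨s, hs, hsub⟩ := (hasBasis_iInf_principal_finite _).mem_iff.1 hunif
  obtain ⟨N, hN⟩ := (hs.image Int.natAbs).bddAbove
  refine ⟨N, fun x y hxy => (hsub (mem_iInter₂.2 fun i hi => ?_ : (x, y) ∈ _)).le⟩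
  have := hN (mem_image_of_mem _ hi)
  exact hxy ⟨by lia, by lia⟩

/-- The sequence that repeats the values of `x` on `[k, k + p)`. -/
def periodicExtension (x : ℤ → A) (k p : ℤ) : ℤ → A := fun i => x (k + i % p)

theorem periodic_periodicExtension (x : ℤ → A) (k p : ℤ) : Periodic (periodicExtension x k p) p :=
  fun i => by simp only [periodicExtension, Int.add_emod_right]

theorem eqOn_shift_periodicExtension {k : ℤ} {N : ℕ} (hp : 0 < p) (hN : N ≤ p)
    (h : EqOn (shift k x) (shift (k + p) x) (Icc (-N) N)) (j : ℤ) :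
    EqOn (shift j (periodicExtension x k p)) (shift (k + j % p) x) (Icc (-N) N) := by
  intro i hi
  have hj := Int.emod_nonneg j hp.ne'
  have hj' := Int.emod_lt_of_pos j hp
  simp only [shift_apply, periodicExtension]
  rw [← Int.emod_add_emod]
  generalize j % p = m at *
  obtain ⟨hi₁, hi₂⟩ := hi
  rcases lt_or_ge (m + i) 0 with hneg | hpos
  · rw [← Int.add_emod_right, Int.emod_eq_of_lt (by lia) (by lia)]
    have := h (show m + i ∈ Icc (-N : ℤ) N from ⟨by lia, by lia⟩)
    simp only [shift_apply] at this
    rw [add_assoc k m, this]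
    congr 1; ring
  · rcases lt_or_ge (m + i) p with hlt | hge
    · rw [Int.emod_eq_of_lt hpos hlt, add_assoc]
    · rw [← Int.sub_emod_right, Int.emod_eq_of_lt (by lia) (by lia)]
      have := h (show m + i - p ∈ Icc (-N : ℤ) N from ⟨by lia, by lia⟩)
      simp only [shift_apply] at this
      rw [this]
      congr 1; ring

theorem frequently_eq_of_periodic {α : Type*} {g : ℤ → α} (hp : 0 < p) (hg : Periodic g p)
    (k : ℤ) : ∃ᶠ j : ℕ in atTop, g j = g k := by
  refine frequently_atTop.2 fun m => ⟨(k + (|k| + m) * p).toNat, ?_, ?_⟩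
  all_goals have hge : |k| + m ≤ (|k| + m) * p := le_mul_of_one_le_right (by positivity) hp
  all_goals have hk := neg_abs_le k
  · lia
  · rw [Int.toNat_of_nonneg (by lia)]
    exact hg.int_mul (|k| + m) k

theorem periodic_shift (hx : Periodic x p) : Periodic (fun k : ℤ => shift k x) p := fun k =>
  funext fun i => by simp only [shift_apply, add_right_comm k p i, hx _]

theorem coe_le_orbitLimsup_of_periodic (hp : 0 < p) (hx : Periodic x p) (k : ℤ) :
    (F (shift k x) : EReal) ≤ orbitLimsup F x :=
  le_limsup_of_frequently_le ((frequently_eq_of_periodic hp (periodic_shift hx) k).mono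
    fun j hj => by rw [hj]) (by isBoundedDefault)

theorem isPath_of_periodic (hp : 0 < p) (hx : Periodic x p) (hT : IsPath T x) (k : ℤ) :
    T (x k) (x (k + 1)) := by
  have hpair : Periodic (fun i => (x i, x (i + 1))) p := fun i => by
    simp only [add_right_comm i p 1, hx _]
  obtain ⟨j, hj⟩ := (frequently_eq_of_periodic hp hpair k).exists
  rw [Prod.mk.injEq] at hj
  exact hj.1 ▸ hj.2 ▸ hT j

theorem isPath_shift_of_periodic (hp : 0 < p) (hx : Periodic x p) (hT : IsPath T x) (k : ℤ) :
    IsPath T (shift k x) := fun j => by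
  simpa only [shift_apply, add_assoc] using isPath_of_periodic hp hx hT (k + j)

theorem exists_eqOn_shift_of_frequently [Finite A] {P : ℕ → Prop} (hP : ∃ᶠ k in atTop, P k)
    (x : ℤ → A) (M N : ℕ) : ∃ k l : ℕ, P k ∧ k + M ≤ l ∧
      EqOn (shift (k : ℤ) x) (shift (l : ℤ) x) (Icc (-N : ℤ) N) := by
  let window (k : ℕ) (i : Icc (-N : ℤ) N) : A := shift (k : ℤ) x i
  obtain ⟨w, hw⟩ : ∃ w, ∃ᶠ k in atTop, P k ∧ window k = w := by
    by_contra! h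
    exact hP ((eventually_all.2 h).mono fun k hk hPk => hk _ hPk rfl)
  obtain ⟨k, hPk, hk⟩ := hw.exists
  obtain ⟨l, hl, -, hlw⟩ := frequently_atTop.1 hw (k + M)
  exact ⟨k, l, hPk, hl, fun i hi => congrFun (hk.trans hlw.symm) ⟨i, hi⟩⟩

theorem exists_abs_le_of_continuous {X : Type*} [TopologicalSpace X] [CompactSpace X] {f : X → ℝ}
    (hf : Continuous f) : ∃ C, ∀ x, |f x| ≤ C :=
  let ⟨C, hC⟩ := isCompact_univ.exists_bound_of_continuousOn hf.continuousOn
  ⟨C, fun x => hC x (mem_univ x)⟩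

theorem exists_orbitLimsup_eq_coe [Finite A] [TopologicalSpace A] (hF : Continuous F) (x : ℤ → A) :
    ∃ a : ℝ, orbitLimsup F x = a := by
  obtain ⟨C, hC⟩ := exists_abs_le_of_continuous hF
  have hle : orbitLimsup F x ≤ C := limsup_le_of_le (by isBoundedDefault)
    (.of_forall fun k => EReal.coe_le_coe_iff.2 (abs_le.1 (hC _)).2)
  have hge : ((-C : ℝ) : EReal) ≤ orbitLimsup F x := le_limsup_of_frequently_le
    (.of_forall fun k => EReal.coe_le_coe_iff.2 (abs_le.1 (hC _)).1) (by isBoundedDefault)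
  exact ⟨_, (EReal.coe_toReal (ne_top_of_le_ne_top (EReal.coe_ne_top _) hle)
    (ne_bot_of_le_ne_bot (EReal.coe_ne_bot _) hge)).symm⟩

theorem isPath_periodicExtension {k : ℕ} (hp : 1 < p) (hx : IsPath T x)
    (h : EqOn (shift (k : ℤ) x) (shift (k + p) x) (Icc (-1 : ℤ) 1)) :
    IsPath T (periodicExtension x k p) := by
  intro j
  have := Int.emod_nonneg j (by lia : p ≠ 0)
  have hpath := hx (k + j % p).toNat
  have hwin := eqOn_shift_periodicExtension (N := 1) (by lia) (by lia) h j
  have h₀ := hwin (show (0 : ℤ) ∈ Icc (-1 : ℤ) 1 by simp)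
  have h₁ := hwin (show (1 : ℤ) ∈ Icc (-1 : ℤ) 1 by simp)
  simp only [shift_apply, add_zero] at h₀ h₁
  rw [Int.toNat_of_nonneg (by lia)] at hpath
  rwa [h₀, h₁]

theorem exists_strictMono_index {P : ℕ → ℕ} (hP : StrictMono P) (hP₀ : P 0 = 0) (j : ℕ) :
    ∃ m, j ∈ Ico (P m) (P (m + 1)) := by
  obtain ⟨m, hm, hm'⟩ := hP.exists_between_of_tendsto_atTop hP.tendsto_atTop
    (by lia : P 0 < j + 1)
  exact ⟨m, by lia, by lia⟩

theorem exists_piecewise {P : ℕ → ℕ} (hP : StrictMono P) (hP₀ : P 0 = 0) (z : ℕ → ℤ → A) :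
    ∃ x : ℤ → A, ∀ m, ∀ i ∈ Ico (P m : ℤ) (P (m + 1)), x i = z m (i - P m) := by
  choose idx hidx using exists_strictMono_index hP hP₀
  refine ⟨fun i => z (idx i.toNat) (i - P (idx i.toNat)), fun m i hi => ?_⟩
  obtain ⟨hi₁, hi₂⟩ := hi
  have hm : idx i.toNat = m := by
    obtain ⟨h₁, h₂⟩ := hidx i.toNat
    have := hP.lt_iff_lt.1 (show P (idx i.toNat) < P (m + 1) by lia)
    have := hP.lt_iff_lt.1 (show P m < P (idx i.toNat + 1) by lia)
    lia
  simp only [hm]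

theorem exists_concatenation {z : ℕ → ℤ → A} {p : ℕ → ℕ} (hp : ∀ m, m + 1 < p m)
    (hz : ∀ m, Periodic (z m) (p m : ℤ)) (hx : ∀ m : ℕ, EqOn (z m) x (Icc (-(m + 1)) (m + 1))) :
    ∃ (c : ℤ → A) (P : ℕ → ℕ), StrictMono P ∧ P 0 = 0 ∧ ∀ m, ∀ j ∈ Ico (P m) (P (m + 1)),
      EqOn (shift (j : ℤ) c) (shift ((j : ℤ) - P m) (z m)) (Icc (-m) (m + 1)) := by
  obtain ⟨P, hP₀, hPsucc⟩ : ∃ P : ℕ → ℕ, P 0 = 0 ∧ ∀ m, P (m + 1) = P m + p m :=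
    ⟨fun m => ∑ l ∈ Finset.range m, p l, Finset.sum_range_zero _, Finset.sum_range_succ _⟩
  have hP : StrictMono P := strictMono_nat_of_lt_succ fun m => by
    have := hp m
    rw [hPsucc]
    lia
  obtain ⟨c, hc⟩ := exists_piecewise hP hP₀ z
  have hnext (m : ℕ) (i : ℤ) (hi : i ∈ Icc (0 : ℤ) (m + 1)) :
      c (P (m + 1) + i) = z m (P (m + 1) + i - P m) := by
    obtain ⟨hi₁, hi₂⟩ := hi
    have := hp (m + 1)
    have := hPsucc (m + 1)
    rw [hc (m + 1) _ ⟨by lia, by lia⟩, add_sub_cancel_left, hx (m + 1) ⟨by lia, by push_cast; lia⟩,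
      ← hx m ⟨by lia, by lia⟩, ← hz m]
    congr 1; rw [hPsucc]; push_cast; ring
  have hprev (m : ℕ) (i : ℤ) (hi : i ∈ Ico (-m : ℤ) 0) : c (P m + i) = z m i := by
    obtain ⟨hi₁, hi₂⟩ := hi
    obtain _ | m := m
    · lia
    have := hp m
    have := hPsucc m
    push_cast at hi₁
    rw [hc m _ ⟨by lia, by lia⟩, hx (m + 1) ⟨by push_cast; lia, by push_cast; lia⟩,
      ← hx m ⟨by lia, by lia⟩, ← hz m i]
    congr 1; rw [hPsucc]; push_cast; ring
  refine ⟨c, P, hP, hP₀, fun m j hj i hi => ?_⟩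
  obtain ⟨hj₁, hj₂⟩ := hj
  obtain ⟨hi₁, hi₂⟩ := hi
  simp only [shift_apply]
  rcases lt_or_ge (j + i) (P m : ℤ) with h | h
  · convert hprev m (j + i - P m) ⟨by lia, by lia⟩ using 2 <;> ring
  rcases lt_or_ge (j + i) (P (m + 1) : ℤ) with h' | h'
  · convert hc m (j + i) ⟨h, h'⟩ using 2; ring
  · convert hnext m (j + i - P (m + 1)) ⟨by lia, by lia⟩ using 2 <;> ring

theorem exists_periodic_forall_le_of_mem_closure {a ε : ℝ}
    (ha : a ∈ closure (periodicSpectrum T F)) (hε : 0 < ε) :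
    ∃ (x : ℤ → A) (p : ℤ), 0 < p ∧ Periodic x p ∧ IsPath T x ∧
      (∀ k : ℤ, F (shift k x) ≤ a + ε) ∧ a - ε ≤ F x := by
  obtain ⟨b, ⟨x, ⟨p, hp, hx⟩, hT, hb⟩, hab⟩ := Metric.mem_closure_iff.1 ha (ε / 2) (by positivity)
  obtain ⟨k, hk⟩ := (limsup_coe_eq_coe_iff.1 hb (ε / 2) (by positivity)).2.exists
  obtain ⟨h₁, h₂⟩ := abs_lt.1 (Real.dist_eq a b ▸ hab)
  refine ⟨shift (k : ℤ) x, p, hp, fun i => ?_, isPath_shift_of_periodic hp hx hT k, fun j => ?_,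
    by linarith⟩
  · simp only [shift_apply, ← add_assoc, hx _]
  · have := coe_le_orbitLimsup_of_periodic (F := F) hp hx (k + j)
    rw [hb, EReal.coe_le_coe_iff, shift_add] at this
    linarith

theorem exists_strictMono_eqOn [Finite A] (y : ℕ → ℤ → A) : ∃ (x : ℤ → A) (φ : ℕ → ℕ),
    StrictMono φ ∧ ∀ m : ℕ, EqOn (y (φ m)) x (Icc (-(m + 1)) (m + 1)) := by
  let _ : TopologicalSpace A := ⊥
  have : DiscreteTopology A := ⟨rfl⟩
  obtain ⟨x, -, ψ, hψ, hx⟩ := isCompact_univ.tendsto_subseq fun m => mem_univ (y m)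
  have hwin (m : ℕ) : ∀ᶠ j in atTop, EqOn (y (ψ j)) x (Icc (-(m + 1)) (m + 1)) := by
    refine (Set.finite_Icc _ _).eventually_all.2 fun i _ => ?_
    simpa only [nhds_discrete, tendsto_pure, comp_apply] using tendsto_pi_nhds.1 hx i
  obtain ⟨θ, hθ, hθx⟩ := extraction_forall_of_eventually hwin
  exact ⟨x, ψ ∘ θ, hψ.comp hθ, hθx⟩

theorem exists_shadowing_path [Finite A] {y : ℕ → ℤ → A} {p : ℕ → ℤ} (hp : ∀ m, 0 < p m)
    (hy : ∀ m, Periodic (y m) (p m)) (hT : ∀ m, IsPath T (y m)) :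
    ∃ (c : ℤ → A) (φ P : ℕ → ℕ), IsPath T c ∧ StrictMono φ ∧ StrictMono P ∧ P 0 = 0 ∧
      ∀ m, ∀ j ∈ Ico (P m) (P (m + 1)),
        EqOn (shift (j : ℤ) c) (shift ((j : ℤ) - P m) (y (φ m))) (Icc (-m) (m + 1)) := by
  obtain ⟨x, φ, hφ, hx⟩ := exists_strictMono_eqOn y
  have hper (m : ℕ) : Periodic (y (φ m)) ((m + 2) * (p (φ m)).toNat : ℕ) := by
    rw [Nat.cast_mul, Int.toNat_of_nonneg (hp _).le]
    exact (hy (φ m)).int_mul _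
  have hlong (m : ℕ) : m + 1 < (m + 2) * (p (φ m)).toNat :=
    Nat.lt_of_lt_of_le (by lia) (Nat.le_mul_of_pos_right _ (by have := hp (φ m); lia))
  obtain ⟨c, P, hP, hP₀, hc⟩ := exists_concatenation hlong hper hx
  refine ⟨c, φ, P, fun j => ?_, hφ, hP, hP₀, hc⟩
  obtain ⟨m, hm⟩ := exists_strictMono_index hP hP₀ j
  have h₀ := hc m j hm (show (0 : ℤ) ∈ Icc (-m : ℤ) (m + 1) from ⟨by lia, by lia⟩)
  have h₁ := hc m j hm (show (1 : ℤ) ∈ Icc (-m : ℤ) (m + 1) from ⟨by lia, by lia⟩)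
  simp only [shift_apply, add_zero] at h₀ h₁
  rw [h₀, h₁]
  exact isPath_of_periodic (hp _) (hy _) (hT _) _

variable [Finite A] [TopologicalSpace A] [DiscreteTopology A]

theorem pathSpectrum_subset_closure (hF : Continuous F) :
    pathSpectrum T F ⊆ closure (periodicSpectrum T F) := by
  rintro a ⟨x, hx, ha⟩
  refine Metric.mem_closure_iff.2 fun ε hε => ?_
  obtain ⟨N, hN⟩ := exists_window_of_continuous hF (show 0 < ε / 4 by positivity)
  obtain ⟨hle, hge⟩ := limsup_coe_eq_coe_iff.1 ha (ε / 4) (by positivity)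
  obtain ⟨m, hm⟩ := eventually_atTop.1 hle
  obtain ⟨k, l, ⟨hFk, hmk⟩, hkl, hwin⟩ := exists_eqOn_shift_of_frequently
    (hge.and_eventually (eventually_ge_atTop m)) x (N + 2) (N + 1)
  obtain ⟨p, rfl⟩ : ∃ p : ℕ, l = k + p := ⟨l - k, by lia⟩
  push_cast at hwin
  have hp : (0 : ℤ) < p := by lia
  set y := periodicExtension x k p
  have hy : Periodic y p := periodic_periodicExtension x k p
  have hclose (j : ℤ) : |F (shift j y) - F (shift (k + j % p) x)| ≤ ε / 4 :=
    hN _ _ (eqOn_shift_periodicExtension hp (by lia)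
      (hwin.mono (Icc_subset_Icc (by lia) (by lia))) j)
  obtain ⟨b, hb⟩ := exists_orbitLimsup_eq_coe hF y
  have hba : b ≤ a + ε / 2 := by
    rw [← EReal.coe_le_coe_iff, ← hb]
    refine limsup_le_of_le (by isBoundedDefault) (.of_forall fun j => EReal.coe_le_coe_iff.2 ?_)
    have := hm (k + j % p) (by lia)
    push_cast at this
    linarith [(abs_le.1 (hclose j)).2]
  have hab : a - ε / 2 ≤ b := by
    rw [← EReal.coe_le_coe_iff, ← hb]
    refine le_trans (EReal.coe_le_coe_iff.2 ?_) (coe_le_orbitLimsup_of_periodic hp hy 0)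
    have := hclose 0
    rw [Int.zero_emod, add_zero] at this
    linarith [(abs_le.1 this).1]
  refine ⟨b, ⟨y, ⟨p, hp, hy⟩, isPath_periodicExtension (by lia) hx
    (hwin.mono (Icc_subset_Icc (by lia) (by lia))), hb⟩, ?_⟩
  rw [Real.dist_eq, abs_lt]
  constructor <;> linarith

theorem closure_periodicSpectrum_subset (hF : Continuous F) :
    closure (periodicSpectrum T F) ⊆ pathSpectrum T F := by
  intro a ha
  choose y p hp hy hT hle hge using fun m : ℕ =>
    exists_periodic_forall_le_of_mem_closure ha (Nat.one_div_pos_of_nat (α := ℝ) (n := m))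
  obtain ⟨c, φ, P, hcT, hφ, hP, hP₀, hc⟩ := exists_shadowing_path hp hy hT
  refine ⟨c, hcT, limsup_coe_eq_coe_iff.2 fun ε hε => ?_⟩
  obtain ⟨N, hN⟩ := exists_window_of_continuous hF (half_pos hε)
  have hlarge : ∀ᶠ m in atTop, N ≤ m ∧ (1 : ℝ) / (φ m + 1) < ε / 2 :=
    (eventually_ge_atTop N).and (hφ.tendsto_atTop.eventually
      (tendsto_one_div_add_atTop_nhds_zero_nat.eventually_lt_const (half_pos hε)))
  obtain ⟨M, hM⟩ := eventually_atTop.1 hlarge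
  have hclose {m j : ℕ} (hm : M ≤ m) (hj : j ∈ Ico (P m) (P (m + 1))) :
      |F (shift (j : ℤ) c) - F (shift ((j : ℤ) - P m) (y (φ m)))| ≤ ε / 2 := by
    have := (hM m hm).1
    exact hN _ _ ((hc m j hj).mono (Icc_subset_Icc (by lia) (by lia)))
  constructor
  · filter_upwards [eventually_ge_atTop (P M)] with j hj
    obtain ⟨m, hm⟩ := exists_strictMono_index hP hP₀ j
    have hMm : M ≤ m := Nat.lt_succ_iff.1 (hP.lt_iff_lt.1 (hj.trans_lt hm.2))
    linarith [(abs_le.1 (hclose hMm hm)).2, hle (φ m) (j - P m), (hM m hMm).2]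
  · refine hP.tendsto_atTop.frequently (Eventually.frequently ?_)
    filter_upwards [eventually_ge_atTop M] with m hm
    have := hclose hm ⟨le_rfl, hP m.lt_succ_self⟩
    rw [sub_self, shift_zero] at this
    linarith [(abs_le.1 this).1, hge (φ m), (hM m hm).2]

theorem pathSpectrum_eq_closure (hF : Continuous F) :
    pathSpectrum T F = closure (periodicSpectrum T F) :=
  (pathSpectrum_subset_closure hF).antisymm (closure_periodicSpectrum_subset hF)

end SymbolicDynamics

noncomputable section Moebius

open Matrix Matrix.GeneralLinearGroup

variable {M : GL (Fin 2) ℤ} {α β ξ η : ℝ} {w : Fin 2 → ℤ}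

/-- The action of `GL₂(ℤ)` on real numbers by fractional linear transformations. It is only used at
irrational numbers, where the denominator does not vanish. -/
def moebius (M : GL (Fin 2) ℤ) (z : ℝ) : ℝ := (M 0 0 * z + M 0 1) / (M 1 0 * z + M 1 1)

/-- The linear form `w ↦ w₀ - α w₁`, which vanishes at the vectors of slope `α`. -/
def linForm (α : ℝ) (w : Fin 2 → ℤ) : ℝ := w 0 - α * w 1

/-- The absolute value of the indefinite binary quadratic form with roots `α` and `β`, normalised to
have discriminant `1`. -/
def normForm (α β : ℝ) (w : Fin 2 → ℤ) : ℝ := |linForm α w| * |linForm β w| / |α - β|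

theorem linForm_ne_zero (hα : Irrational α) (hw : w ≠ 0) : linForm α w ≠ 0 := by
  intro h
  have hw₁ : w 1 = 0 := by
    by_contra hw₁
    refine hα ⟨w 0 / w 1, ?_⟩
    have : (w 1 : ℝ) ≠ 0 := Int.cast_ne_zero.2 hw₁
    push_cast
    field_simp
    exact sub_eq_zero.1 h ▸ mul_comm _ _
  have hw₀ : w 0 = 0 := by simpa [linForm, hw₁] using h
  exact hw (funext fun i => by fin_cases i <;> assumption)

theorem normForm_pos (hα : Irrational α) (hβ : Irrational β) (hαβ : α ≠ β) (hw : w ≠ 0) :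
    0 < normForm α β w :=
  div_pos (mul_pos (abs_pos.2 (linForm_ne_zero hα hw)) (abs_pos.2 (linForm_ne_zero hβ hw)))
    (abs_pos.2 (sub_ne_zero.2 hαβ))

theorem det_eq_one_or_neg_one (M : GL (Fin 2) ℤ) :
    M 0 0 * M 1 1 - M 0 1 * M 1 0 = 1 ∨ M 0 0 * M 1 1 - M 0 1 * M 1 0 = -1 := by
  rw [← Matrix.det_fin_two]
  exact Int.isUnit_iff.1 ((Matrix.isUnit_iff_isUnit_det _).1 M.isUnit)

theorem abs_det_eq_one (M : GL (Fin 2) ℤ) : |(M 0 0 * M 1 1 - M 0 1 * M 1 0 : ℝ)| = 1 := by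
  rcases det_eq_one_or_neg_one M with h | h <;> rify at h <;> rw [h] <;> norm_num

theorem moebius_denom_ne_zero (M : GL (Fin 2) ℤ) (hα : Irrational α) :
    (M 1 0 : ℝ) * α + M 1 1 ≠ 0 := by
  have hrow : ![M 1 1, -M 1 0] ≠ 0 := fun h => by
    have h₀ := congrFun h 0
    have h₁ := congrFun h 1
    simp only [cons_val_zero, cons_val_one, Pi.zero_apply, neg_eq_zero] at h₀ h₁
    simpa [h₀, h₁] using det_eq_one_or_neg_one M
  convert linForm_ne_zero hα hrow using 1
  simp only [linForm, cons_val_zero, cons_val_one, Int.cast_neg]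
  ring

theorem moebius_one (z : ℝ) : moebius 1 z = z := by simp [moebius]

theorem moebius_mul (M N : GL (Fin 2) ℤ) (hα : Irrational α) :
    moebius (M * N) α = moebius M (moebius N α) := by
  have := moebius_denom_ne_zero N hα
  simp only [moebius, Units.val_mul, mul_apply, Fin.sum_univ_two]
  push_cast
  field_simp
  congr 1 <;> ring

theorem abs_linForm_mulVec (M : GL (Fin 2) ℤ) (hα : Irrational α) (w : Fin 2 → ℤ) :
    |linForm (moebius M α) (M.1 *ᵥ w)| = |linForm α w| / |M 1 0 * α + M 1 1| := by
  have hden := moebius_denom_ne_zero M hα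
  have : linForm (moebius M α) (M.1 *ᵥ w) =
      (M 0 0 * M 1 1 - M 0 1 * M 1 0) * linForm α w / (M 1 0 * α + M 1 1) := by
    simp only [linForm, moebius, mulVec, dotProduct, Fin.sum_univ_two, Int.cast_add, Int.cast_mul]
    rw [eq_div_iff hden, sub_mul, mul_right_comm, div_mul_cancel₀ _ hden]
    ring
  rw [this, abs_div, abs_mul, abs_det_eq_one, one_mul]

theorem abs_moebius_sub_moebius (M : GL (Fin 2) ℤ) (hα : Irrational α) (hβ : Irrational β) :
    |moebius M α - moebius M β| =
      |α - β| / (|M 1 0 * α + M 1 1| * |M 1 0 * β + M 1 1|) := by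
  have hα' := moebius_denom_ne_zero M hα
  have hβ' := moebius_denom_ne_zero M hβ
  have : moebius M α - moebius M β = (M 0 0 * M 1 1 - M 0 1 * M 1 0) * (α - β) /
      ((M 1 0 * α + M 1 1) * (M 1 0 * β + M 1 1)) := by
    rw [moebius, moebius, div_sub_div _ _ hα' hβ']
    congr 1; ring
  rw [this, abs_div, abs_mul, abs_mul, abs_det_eq_one, one_mul]

theorem moebius_ne_moebius (M : GL (Fin 2) ℤ) (hα : Irrational α) (hβ : Irrational β)
    (hαβ : α ≠ β) : moebius M α ≠ moebius M β := by
  rw [← sub_ne_zero, ← abs_pos, abs_moebius_sub_moebius M hα hβ]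
  exact div_pos (abs_pos.2 (sub_ne_zero.2 hαβ)) (mul_pos (abs_pos.2 (moebius_denom_ne_zero M hα))
    (abs_pos.2 (moebius_denom_ne_zero M hβ)))

theorem normForm_mulVec (M : GL (Fin 2) ℤ) (hα : Irrational α) (hβ : Irrational β)
    (w : Fin 2 → ℤ) :
    normForm (moebius M α) (moebius M β) (M.1 *ᵥ w) = normForm α β w := by
  have hα' := abs_ne_zero.2 (moebius_denom_ne_zero M hα)
  have hβ' := abs_ne_zero.2 (moebius_denom_ne_zero M hβ)
  simp only [normForm, abs_linForm_mulVec M hα, abs_linForm_mulVec M hβ,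
    abs_moebius_sub_moebius M hα hβ]
  field_simp

theorem mulVec_ne_zero (M : GL (Fin 2) ℤ) (hw : w ≠ 0) : M.1 *ᵥ w ≠ 0 := fun h => hw <| by
  rw [← one_mulVec w, ← Units.val_one, ← inv_mul_cancel M, Units.val_mul, ← mulVec_mulVec, h,
    mulVec_zero]

theorem irrational_moebius (M : GL (Fin 2) ℤ) (hα : Irrational α) : Irrational (moebius M α) := by
  rintro ⟨q, hq⟩
  have hv : ![q.num, q.den] ≠ 0 := fun h => by simpa using congrFun h 1
  have hzero : linForm (moebius M α) ![q.num, q.den] = 0 := by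
    rw [linForm, ← hq, cons_val_zero, cons_val_one, cons_val_zero]
    exact_mod_cast sub_eq_zero.2 (Rat.mul_den_eq_num q).symm
  have hlin := abs_linForm_mulVec M hα (M⁻¹.1 *ᵥ ![q.num, q.den])
  rw [mulVec_mulVec, ← Units.val_mul, mul_inv_cancel, Units.val_one, one_mulVec, hzero,
    abs_zero, eq_comm, div_eq_zero_iff, abs_eq_zero, abs_eq_zero] at hlin
  exact hlin.elim (linForm_ne_zero hα (mulVec_ne_zero _ hv)) (moebius_denom_ne_zero M hα)

theorem isCoprime_mulVec (M : GL (Fin 2) ℤ) (hw : IsCoprime (w 0) (w 1)) :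
    IsCoprime ((M.1 *ᵥ w) 0) ((M.1 *ᵥ w) 1) := by
  obtain ⟨a, b, hab⟩ := hw
  have h : ![a, b] ᵥ* M⁻¹.1 ⬝ᵥ M.1 *ᵥ w = 1 := by
    rw [← dotProduct_mulVec, mulVec_mulVec, ← Units.val_mul, inv_mul_cancel, Units.val_one,
      one_mulVec]
    simpa [dotProduct] using hab
  exact ⟨_, _, by simpa only [dotProduct, Fin.sum_univ_two] using h⟩

theorem linForm_eq_mul (α : ℝ) (hw₁ : w 1 ≠ 0) :
    linForm α w = w 1 * ((w 0 / w 1 : ℚ) - α) := by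
  have hw₁' : (w 1 : ℝ) ≠ 0 := Int.cast_ne_zero.2 hw₁
  push_cast
  rw [linForm, mul_sub, mul_div_cancel₀ _ hw₁', mul_comm α]

theorem nQuality_div (n : ℕ) (ξ : ℝ) (hw : IsCoprime (w 0) (w 1)) (hw₁ : w 1 ≠ 0) :
    nQuality n ξ (w 0 / w 1) = (w 1).gcd n / (|(w 1 : ℝ)| * |linForm ξ w|) := by
  have hden : ((w 0 : ℚ) / w 1).den = (w 1).natAbs := by
    rw [← Rat.divInt_eq_div, Rat.den_divInt, if_neg hw₁, Int.isCoprime_iff_gcd_eq_one.1 hw.symm,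
      Nat.div_one]
  rw [nQuality, hden, linForm_eq_mul ξ hw₁, abs_mul, ← mul_assoc, ← sq, Nat.cast_natAbs,
    Int.cast_abs, Int.gcd_def, Int.natAbs_natCast]

/-- The ratio by which the `n`-quality of `q` differs from its `GL₂(ℤ)`-invariant counterpart, in
which `normForm` takes the place of the denominator. It tends to `1` as `q` tends to `ξ`. -/
def distortion (ξ η : ℝ) (q : ℚ) : ℝ := |(q : ℝ) - η| / |ξ - η|

theorem distortion_pos (hη : Irrational η) (hξη : ξ ≠ η) (q : ℚ) : 0 < distortion ξ η q :=
  div_pos (abs_pos.2 (sub_ne_zero.2 fun h => hη ⟨q, h⟩)) (abs_pos.2 (sub_ne_zero.2 hξη))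

theorem normForm_eq_mul_distortion (ξ η : ℝ) (hw₁ : w 1 ≠ 0) :
    normForm ξ η w = |linForm ξ w| * (|(w 1 : ℝ)| * distortion ξ η (w 0 / w 1)) := by
  rw [normForm, linForm_eq_mul η hw₁, distortion, abs_mul, mul_div_assoc, mul_div_assoc]

theorem nQuality_div_eq_mul_distortion (n : ℕ) (hη : Irrational η) (hξη : ξ ≠ η)
    (hw : IsCoprime (w 0) (w 1)) (hw₁ : w 1 ≠ 0) :
    nQuality n ξ (w 0 / w 1) =
      (w 1).gcd n / normForm ξ η w * distortion ξ η (w 0 / w 1) := by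
  have := (distortion_pos hη hξη (w 0 / w 1)).ne'
  rw [nQuality_div n ξ hw hw₁, normForm_eq_mul_distortion ξ η hw₁]
  field_simp

theorem isQuadraticIrrational_of_moebius_eq_self (hξ : Irrational ξ) (hM : moebius M ξ = ξ)
    (h₁ : M ≠ 1) (h₂ : M ≠ -1) : IsQuadraticIrrational ξ := by
  have hquad : (M 1 0 : ℝ) * ξ ^ 2 + (M 1 1 - M 0 0 : ℤ) * ξ + (-M 0 1 : ℤ) = 0 := by
    rw [moebius, div_eq_iff (moebius_denom_ne_zero M hξ)] at hM
    push_cast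
    linarith
  refine ⟨hξ, M 1 0, M 1 1 - M 0 0, -M 0 1, fun h₁₀ => ?_, hquad⟩
  have hscalar : ![-M 0 1, M 0 0 - M 1 1] = 0 := by
    by_contra h
    refine linForm_ne_zero hξ h ?_
    rw [h₁₀] at hquad
    simp only [linForm, cons_val_zero, cons_val_one]
    push_cast at hquad ⊢
    linarith
  have h₀₁ := congrFun hscalar 0
  have h₁₁ := congrFun hscalar 1
  simp only [cons_val_zero, cons_val_one, Pi.zero_apply, neg_eq_zero, sub_eq_zero] at h₀₁ h₁₁
  have hdet : M 1 1 * M 1 1 = 1 ∨ M 1 1 * M 1 1 = -1 := by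
    simpa only [h₁₀, h₀₁, h₁₁, zero_mul, sub_zero] using det_eq_one_or_neg_one M
  have hsq : M 1 1 = 1 ∨ M 1 1 = -1 :=
    mul_self_eq_one_iff.1 (hdet.resolve_right fun h => by linarith [mul_self_nonneg (M 1 1)])
  rcases hsq with h | h
  · exact h₁ (Units.ext (by ext i j; fin_cases i <;> fin_cases j <;> simp [*]))
  · exact h₂ (Units.ext (by ext i j; fin_cases i <;> fin_cases j <;> simp [*]))

end Moebius

noncomputable section ContinuedFractions

open Matrix Matrix.GeneralLinearGroup

variable {b : ℕ → ℤ} {z z' : ℕ → ℝ} {ρ L : ℝ}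

/-- The matrix of `z ↦ b + 1 / z`. -/
def stepMatrix (b : ℤ) : GL (Fin 2) ℤ where
  val := !![b, 1; 1, 0]
  inv := !![0, 1; 1, -b]
  val_inv := by simp [one_fin_two]
  inv_val := by simp [one_fin_two]

/-- The product of the first `k` step matrices of the digits `b`. Its columns are the `k`-th and the
`(k - 1)`-st convergent of the continued fraction with these digits. -/
def convergentMatrix (b : ℕ → ℤ) : ℕ → GL (Fin 2) ℤ
  | 0 => 1
  | k + 1 => convergentMatrix b k * stepMatrix (b k)

theorem moebius_stepMatrix (b : ℤ) {z : ℝ} (hz : z ≠ 0) : moebius (stepMatrix b) z = b + z⁻¹ := by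
  simp [moebius, stepMatrix, add_div, hz]

theorem convergentMatrix_succ_apply_zero (b : ℕ → ℤ) (k : ℕ) (i : Fin 2) :
    convergentMatrix b (k + 1) i 0 =
      b k * convergentMatrix b k i 0 + convergentMatrix b k i 1 := by
  simp [convergentMatrix, stepMatrix, mul_apply, mul_comm]

theorem convergentMatrix_succ_apply_one (b : ℕ → ℤ) (k : ℕ) (i : Fin 2) :
    convergentMatrix b (k + 1) i 1 = convergentMatrix b k i 0 := by
  simp [convergentMatrix, stepMatrix, mul_apply]

theorem fib_le_convergentMatrix (hb : ∀ k, 1 ≤ b (k + 1)) (k : ℕ) :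
    (k.fib : ℤ) ≤ convergentMatrix b k 1 0 := by
  induction k using Nat.twoStepInduction with
  | zero => simp [convergentMatrix]
  | one => simp [convergentMatrix, stepMatrix]
  | more k ih ih' =>
    have hpos : 0 ≤ convergentMatrix b (k + 1) 1 0 := (Int.natCast_nonneg _).trans ih'
    rw [convergentMatrix_succ_apply_zero, convergentMatrix_succ_apply_one, Nat.fib_add_two]
    push_cast
    linarith [le_mul_of_one_le_left hpos (hb k)]

theorem moebius_convergentMatrix (hz : ∀ k, z k = b k + (z (k + 1))⁻¹)
    (hirr : ∀ k, Irrational (z k)) (k : ℕ) : moebius (convergentMatrix b k) (z k) = z 0 := by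
  induction k with
  | zero => exact moebius_one _
  | succ k ih =>
    rw [convergentMatrix, moebius_mul _ _ (hirr _), moebius_stepMatrix _ (hirr _).ne_zero, ← hz, ih]

theorem abs_linForm_inv_convergentMatrix_succ (hz : ∀ k, z k = b k + (z (k + 1))⁻¹)
    (hirr : ∀ k, Irrational (z k)) (v : Fin 2 → ℤ) (k : ℕ) :
    |linForm (z (k + 1)) ((convergentMatrix b (k + 1))⁻¹.1 *ᵥ v)| =
      |z (k + 1)| * |linForm (z k) ((convergentMatrix b k)⁻¹.1 *ᵥ v)| := by
  have hstep := abs_linForm_mulVec (stepMatrix (b k)) (hirr (k + 1))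
    ((convergentMatrix b (k + 1))⁻¹.1 *ᵥ v)
  rw [moebius_stepMatrix _ (hirr _).ne_zero, ← hz, mulVec_mulVec, ← Units.val_mul, convergentMatrix,
    _root_.mul_inv_rev, mul_inv_cancel_left] at hstep
  have hden : stepMatrix (b k) 1 0 * z (k + 1) + stepMatrix (b k) 1 1 = z (k + 1) := by
    simp [stepMatrix]
  rw [convergentMatrix, _root_.mul_inv_rev, hstep, hden,
    mul_div_cancel₀ _ (abs_ne_zero.2 (hirr _).ne_zero)]

theorem le_abs_linForm_inv_convergentMatrix (hz : ∀ k, z k = b k + (z (k + 1))⁻¹)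
    (hirr : ∀ k, Irrational (z k)) (hρ₀ : 0 ≤ ρ) (hρ : ∀ k, ρ ≤ |z k|) (v : Fin 2 → ℤ) (k : ℕ) :
    ρ ^ k * |linForm (z 0) v| ≤ |linForm (z k) ((convergentMatrix b k)⁻¹.1 *ᵥ v)| := by
  induction k with
  | zero => simp [convergentMatrix]
  | succ k ih =>
    rw [abs_linForm_inv_convergentMatrix_succ hz hirr, pow_succ', mul_assoc]
    exact mul_le_mul (hρ _) ih (by positivity) (abs_nonneg _)

theorem den_lt_den_of_eq_add_inv {q r : ℚ} {b : ℤ} (h : q = b + r⁻¹) (hr : 1 < r) :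
    r.den < q.den := by
  have hnum : (r.den : ℤ) < r.num := by
    simpa using (Rat.lt_iff 1 r).1 hr
  have hden : q.den = r.num.natAbs := by
    rw [h, add_comm, Rat.add_intCast_den, Rat.den_inv_of_ne_zero (by positivity)]
  lia

theorem irrational_of_eq_add_inv (hz : ∀ k, z k = b k + (z (k + 1))⁻¹)
    (h₁ : ∀ k, 1 < z (k + 1)) : Irrational (z 0) := by
  have hdescent (m : ℕ) : ∀ k, ∀ q : ℚ, q.den = m → (q : ℝ) ≠ z k := by
    induction m using Nat.strong_induction_on with
    | _ m ih =>
      rintro k q rfl hq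
      have hr : (((q - b k)⁻¹ : ℚ) : ℝ) = z (k + 1) := by
        push_cast
        rw [hq, hz k, add_sub_cancel_left, inv_inv]
      refine ih _ (den_lt_den_of_eq_add_inv (b := b k) ?_ ?_) (k + 1) _ rfl hr
      · rw [inv_inv, add_sub_cancel]
      · exact_mod_cast hr ▸ h₁ k
  rintro ⟨q, hq⟩
  exact hdescent _ 0 q rfl hq

theorem abs_inv_sub_inv_le (hρ : 0 < ρ) {y z : ℝ} (hy : ρ ≤ y) (hz : ρ ≤ z) :
    |y⁻¹ - z⁻¹| ≤ (ρ ^ 2)⁻¹ * |y - z| := by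
  have hy₀ := hρ.trans_le hy
  have hz₀ := hρ.trans_le hz
  rw [inv_sub_inv hy₀.ne' hz₀.ne', abs_div, abs_of_pos (mul_pos hy₀ hz₀), abs_sub_comm,
    div_eq_inv_mul, sq]
  gcongr

theorem eq_of_eq_add_inv (hz : ∀ k, z k = b k + (z (k + 1))⁻¹)
    (hz' : ∀ k, z' k = b k + (z' (k + 1))⁻¹) (hρ : 1 < ρ) (hbd : ∀ k, z k ∈ Set.Icc ρ L)
    (hbd' : ∀ k, z' k ∈ Set.Icc ρ L) : z 0 = z' 0 := by
  have hρ₀ : 0 < ρ := one_pos.trans hρ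
  have hcontr (k : ℕ) : |z 0 - z' 0| ≤ (ρ ^ 2)⁻¹ ^ k * |z k - z' k| := by
    induction k with
    | zero => simp
    | succ k ih =>
      refine ih.trans ?_
      rw [hz k, hz' k, add_sub_add_left_eq_sub, pow_succ _ k, mul_assoc]
      gcongr
      exact abs_inv_sub_inv_le hρ₀ (hbd _).1 (hbd' _).1
  have hle (k : ℕ) : |z 0 - z' 0| ≤ (ρ ^ 2)⁻¹ ^ k * (L - ρ) := by
    refine (hcontr k).trans ?_
    gcongr
    exact Real.dist_le_of_mem_Icc (hbd k) (hbd' k)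
  have hlim : Tendsto (fun k : ℕ => (ρ ^ 2)⁻¹ ^ k * (L - ρ)) atTop (𝓝 0) := by
    simpa using (tendsto_pow_atTop_nhds_zero_of_lt_one (by positivity)
      (inv_lt_one_of_one_lt₀ (one_lt_pow₀ hρ two_ne_zero))).mul_const (L - ρ)
  exact sub_eq_zero.1 (abs_nonpos_iff.1 (ge_of_tendsto' hlim hle))

theorem exists_continuous_eq_add_inv {X : Type*} [TopologicalSpace X] [CompactSpace X] {σ : X → X}
    (hσ : Continuous σ) {δ : X → ℝ} (hδ : Continuous δ) (hδL : ∀ x, δ x ∈ Set.Icc 1 (L - 1)) :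
    ∃ f : X → ℝ, Continuous f ∧ ∀ x, f x = δ x + (f (σ x))⁻¹ ∧ f x ∈ Set.Icc (1 + L⁻¹) L := by
  rcases isEmpty_or_nonempty X with _ | ⟨⟨x₀⟩⟩
  · exact ⟨0, continuous_const, isEmptyElim⟩
  have hL : 2 ≤ L := by linarith [(hδL x₀).1, (hδL x₀).2]
  set ρ := 1 + L⁻¹ with hρ_def
  have hρ : 1 < ρ := by rw [hρ_def]; linarith [inv_pos.2 (two_pos.trans_le hL)]
  have hρL : ρ ≤ L := by rw [hρ_def]; linarith [inv_le_one_of_one_le₀ (one_le_two.trans hL)]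
  have hρ₀ : 0 < ρ := one_pos.trans hρ
  let S (f : C(X, ℝ)) : C(X, ℝ) :=
    ⟨fun x => δ x + (max (f (σ x)) ρ)⁻¹, hδ.add <| Continuous.inv₀ (by fun_prop) fun x =>
      (hρ₀.trans_le (le_max_right _ _)).ne'⟩
  have hS : ContractingWith (Real.toNNReal (ρ ^ 2)⁻¹) S := by
    refine ⟨Real.toNNReal_lt_one.2 (inv_lt_one_of_one_lt₀ (one_lt_pow₀ hρ two_ne_zero)),
      LipschitzWith.of_dist_le_mul fun f g => ?_⟩
    rw [Real.coe_toNNReal _ (by positivity)]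
    refine (ContinuousMap.dist_le (by positivity)).2 fun x => ?_
    change |δ x + _ - (δ x + _)| ≤ _
    rw [add_sub_add_left_eq_sub]
    refine (abs_inv_sub_inv_le hρ₀ (le_max_right _ _) (le_max_right _ _)).trans ?_
    gcongr
    exact (abs_max_sub_max_le_abs _ _ _).trans
      ((Real.dist_eq _ _).symm.trans_le (ContinuousMap.dist_apply_le_dist (σ x)))
  have : Inhabited C(X, ℝ) := ⟨0⟩
  set f := ContractingWith.fixedPoint S hS
  have hf (x : X) : f x = δ x + (max (f (σ x)) ρ)⁻¹ :=
    congrArg (· x) (hS.fixedPoint_isFixedPt).symm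
  have hfL (x : X) : f x ≤ L := by
    rw [hf]
    linarith [(hδL x).2, inv_le_one_of_one_le₀ (hρ.le.trans (le_max_right (f (σ x)) ρ))]
  have hfρ (x : X) : ρ ≤ f x := by
    rw [hf]
    linarith [(hδL x).1, inv_anti₀ (hρ₀.trans_le (le_max_right (f (σ x)) ρ)) (max_le (hfL _) hρL)]
  exact ⟨f, f.continuous, fun x => ⟨by rw [hf, max_eq_left (hfρ _)], hfρ x, hfL x⟩⟩

end ContinuedFractions

noncomputable section Coding

open Function Matrix Matrix.GeneralLinearGroup SymbolicDynamics.FullShift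

/-- Reduction modulo `n` of integral invertible matrices. -/
def reduction (n : ℕ) : GL (Fin 2) ℤ →* GL (Fin 2) (ZMod n) := map (Int.castRingHom (ZMod n))

/-- The letters of the coding: a partial quotient bounded by `K`, together with the reduction modulo
`n` of the change of basis accumulated before it. -/
structure Letter (K n : ℕ) where
  /-- The partial quotient. -/
  digit : Set.Icc (1 : ℤ) K
  /-- The reduction modulo `n` of the product of the preceding step matrices. -/
  residue : (reduction n).range

variable {K n : ℕ} {x : ℤ → Letter K n}

instance : TopologicalSpace (Letter K n) := ⊥

instance : DiscreteTopology (Letter K n) := ⟨rfl⟩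

instance [NeZero n] : Finite (Letter K n) :=
  Finite.of_injective (fun l => (l.digit, l.residue)) fun l l' h => by
    cases l; cases l'; simpa using h

/-- The transitions of the coding: the residue is updated by the step matrix of the digit. -/
def Transition (l l' : Letter K n) : Prop :=
  l'.residue.1 = l.residue * reduction n (stepMatrix l.digit)

/-- The partial quotients on the nonnegative half of a two-sided sequence. -/
def digits (x : ℤ → Letter K n) (k : ℕ) : ℤ := (x k).digit

theorem residue_eq_of_isPath (hx : IsPath Transition x) (k : ℕ) :
    (x k).residue.1 = (x 0).residue * reduction n (convergentMatrix (digits x) k) := by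
  induction k with
  | zero => simp [convergentMatrix]
  | succ k ih =>
    rw [convergentMatrix, map_mul, ← mul_assoc, ← ih]
    exact_mod_cast hx k

variable [NeZero n]

theorem exists_continuous_eq_digit_add_inv (j i : ℤ) : ∃ f : (ℤ → Letter K n) → ℝ,
    Continuous f ∧ ∀ x, f x = (x i).digit + (f (shift j x))⁻¹ ∧
      f x ∈ Set.Icc (1 + (K + 1 : ℝ)⁻¹) (K + 1) := by
  refine exists_continuous_eq_add_inv (continuous_shift j)
    ((continuous_of_discreteTopology (f := fun l : Letter K n => ((l.digit : ℤ) : ℝ))).comp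
      (continuous_apply i)) fun x => ?_
  obtain ⟨h₁, h₂⟩ := (x i).digit.2
  exact ⟨by exact_mod_cast h₁, by rw [add_sub_cancel_right]; exact_mod_cast h₂⟩

/-- The continued fraction whose partial quotients are the digits at `i, i + j, i + 2j, …`. -/
def digitFraction (j i : ℤ) : (ℤ → Letter K n) → ℝ :=
  (exists_continuous_eq_digit_add_inv j i).choose

theorem continuous_digitFraction (j i : ℤ) : Continuous (digitFraction (K := K) (n := n) j i) :=
  (exists_continuous_eq_digit_add_inv j i).choose_spec.1

theorem digitFraction_eq (j i : ℤ) (x : ℤ → Letter K n) :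
    digitFraction j i x = (x i).digit + (digitFraction j i (shift j x))⁻¹ :=
  ((exists_continuous_eq_digit_add_inv j i).choose_spec.2 x).1

theorem digitFraction_mem_Icc (j i : ℤ) (x : ℤ → Letter K n) :
    digitFraction j i x ∈ Set.Icc (1 + (K + 1 : ℝ)⁻¹) (K + 1) :=
  ((exists_continuous_eq_digit_add_inv j i).choose_spec.2 x).2

theorem one_lt_digitFraction (j i : ℤ) (x : ℤ → Letter K n) : 1 < digitFraction j i x :=
  (lt_add_of_pos_right 1 (by positivity)).trans_le (digitFraction_mem_Icc j i x).1

theorem irrational_digitFraction (j i : ℤ) (x : ℤ → Letter K n) :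
    Irrational (digitFraction j i x) := by
  have h := irrational_of_eq_add_inv (b := fun k => (x (k * j + i)).digit)
    (z := fun k => digitFraction j i (shift (k * j) x)) (fun k => ?_)
    fun k => one_lt_digitFraction _ _ _
  · simpa only [Nat.cast_zero, zero_mul, shift_zero] using h
  · push_cast
    rw [digitFraction_eq, add_one_mul, shift_add, shift_apply]

/-- The continued fraction whose partial quotients are the digits at `0, 1, 2, …`. -/
def forwardEnd (x : ℤ → Letter K n) : ℝ := digitFraction 1 0 x

/-- The number `-1 / [a₋₁; a₋₂, a₋₃, …]`, where `aᵢ` is the digit at `i`. With this sign and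
inversion, both ends of a sequence transform by the same matrix under the shift. -/
def backwardEnd (x : ℤ → Letter K n) : ℝ := -(digitFraction (-1) (-1) x)⁻¹

theorem one_lt_forwardEnd (x : ℤ → Letter K n) : 1 < forwardEnd x := one_lt_digitFraction 1 0 x

theorem forwardEnd_mem_Icc (x : ℤ → Letter K n) :
    forwardEnd x ∈ Set.Icc (1 + (K + 1 : ℝ)⁻¹) (K + 1) := digitFraction_mem_Icc 1 0 x

theorem backwardEnd_mem_Ioo (x : ℤ → Letter K n) : backwardEnd x ∈ Set.Ioo (-1) 0 := by
  have h := one_lt_digitFraction (-1) (-1) x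
  exact ⟨neg_lt_neg (inv_lt_one_of_one_lt₀ h), neg_neg_of_pos (inv_pos.2 (one_pos.trans h))⟩

theorem one_lt_forwardEnd_sub_backwardEnd (x : ℤ → Letter K n) :
    1 < forwardEnd x - backwardEnd x := by
  linarith [one_lt_forwardEnd x, (backwardEnd_mem_Ioo x).2]

theorem forwardEnd_ne_backwardEnd (x : ℤ → Letter K n) : forwardEnd x ≠ backwardEnd x :=
  sub_ne_zero.1 (one_pos.trans (one_lt_forwardEnd_sub_backwardEnd x)).ne'

theorem continuous_forwardEnd : Continuous (forwardEnd (K := K) (n := n)) :=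
  continuous_digitFraction 1 0

theorem continuous_backwardEnd : Continuous (backwardEnd (K := K) (n := n)) :=
  ((continuous_digitFraction _ _).inv₀ fun x =>
    (one_pos.trans (one_lt_digitFraction _ _ x)).ne').neg

theorem irrational_forwardEnd (x : ℤ → Letter K n) : Irrational (forwardEnd x) :=
  irrational_digitFraction 1 0 x

theorem irrational_backwardEnd (x : ℤ → Letter K n) : Irrational (backwardEnd x) :=
  (irrational_digitFraction (-1) (-1) x).inv.neg

theorem forwardEnd_shift (x : ℤ → Letter K n) (k : ℕ) :
    forwardEnd (shift (k : ℤ) x) = digits x k + (forwardEnd (shift ((k + 1 : ℕ) : ℤ) x))⁻¹ := by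
  rw [forwardEnd, digitFraction_eq, ← shift_add, shift_apply, add_zero, Nat.cast_succ]
  rfl

theorem backwardEnd_shift (x : ℤ → Letter K n) (k : ℕ) :
    backwardEnd (shift (k : ℤ) x) = digits x k + (backwardEnd (shift ((k + 1 : ℕ) : ℤ) x))⁻¹ := by
  have h := digitFraction_eq (-1) (-1) (shift ((k + 1 : ℕ) : ℤ) x)
  rw [← shift_add, shift_apply, Nat.cast_succ, add_neg_cancel_right] at h
  rw [backwardEnd, backwardEnd, inv_neg, inv_inv, Nat.cast_succ, h, digits]
  ring

theorem moebius_convergentMatrix_forwardEnd (x : ℤ → Letter K n) (k : ℕ) :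
    moebius (convergentMatrix (digits x) k) (forwardEnd (shift (k : ℤ) x)) = forwardEnd x := by
  have h := moebius_convergentMatrix (forwardEnd_shift x) (fun _ => irrational_forwardEnd _) k
  rwa [Nat.cast_zero, shift_zero] at h

theorem moebius_convergentMatrix_backwardEnd (x : ℤ → Letter K n) (k : ℕ) :
    moebius (convergentMatrix (digits x) k) (backwardEnd (shift (k : ℤ) x)) = backwardEnd x := by
  have h := moebius_convergentMatrix (backwardEnd_shift x) (fun _ => irrational_backwardEnd _) k
  rwa [Nat.cast_zero, shift_zero] at h

end Coding

noncomputable section LocalQuality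

open Function Matrix Matrix.GeneralLinearGroup SymbolicDynamics.FullShift

variable {K n : ℕ} {g : GL (Fin 2) ℤ} {v w : Fin 2 → ℤ} {R : ℤ}

/-- The primitive integer vectors with entries bounded by `R`. -/
def primitiveBox (R : ℤ) : Finset (Fin 2 → ℤ) :=
  (Finset.Icc (fun _ => -R) fun _ => R).filter fun w => IsCoprime (w 0) (w 1)

theorem mem_primitiveBox :
    w ∈ primitiveBox R ↔ (|w 0| ≤ R ∧ |w 1| ≤ R) ∧ IsCoprime (w 0) (w 1) := by
  simp only [primitiveBox, Finset.mem_filter, Finset.mem_Icc, Pi.le_def, Fin.forall_fin_two, abs_le]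
  tauto

theorem ne_zero_of_isCoprime (hw : IsCoprime (w 0) (w 1)) : w ≠ 0 := by
  rintro rfl
  exact not_isCoprime_zero_zero hw

/-- The gcd with `n` of the lower entry of `h w`, for a matrix `h` over `ℤ/n`. -/
def lowerGcd (h : GL (Fin 2) (ZMod n)) (w : Fin 2 → ℤ) : ℕ :=
  ((h.1 *ᵥ fun i => (w i : ZMod n)) 1).val.gcd n

variable [NeZero n] {x : ℤ → Letter K n}

theorem lowerGcd_reduction (g : GL (Fin 2) ℤ) (w : Fin 2 → ℤ) :
    lowerGcd (reduction n g) w = ((g.1 *ᵥ w) 1).gcd n := by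
  have hcast : ((reduction n g).1 *ᵥ fun i => (w i : ZMod n)) 1 = ((g.1 *ᵥ w) 1 : ℤ) := by
    simp [reduction, mulVec, dotProduct]
  rw [lowerGcd, hcast, ← Int.gcd_natCast_natCast, ZMod.val_intCast, Int.gcd_emod]

/-- The contribution of `w` to the local quality at `x`. -/
def markedQuality (x : ℤ → Letter K n) (w : Fin 2 → ℤ) : ℝ :=
  lowerGcd (x 0).residue.1 w / normForm (forwardEnd x) (backwardEnd x) w

/-- A bound for the entries of the vectors `w` that can contribute to `localQuality`. -/
def boxRadius (K n : ℕ) : ℤ := (K + 1) * (n + K + 2)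

theorem unit_mem_primitiveBox (K n : ℕ) : ![1, 0] ∈ primitiveBox (boxRadius K n) := by
  have hpos : 0 < boxRadius K n := by unfold boxRadius; positivity
  exact mem_primitiveBox.2 ⟨⟨by simpa using Int.add_one_le_of_lt hpos, by simpa using hpos.le⟩,
    isCoprime_one_left⟩

/-- The largest contribution to the quality at the current position. -/
def localQuality (x : ℤ → Letter K n) : ℝ :=
  (primitiveBox (boxRadius K n)).sup' ⟨_, unit_mem_primitiveBox K n⟩ (markedQuality x)

theorem continuous_localQuality : Continuous (localQuality (K := K) (n := n)) := by
  refine Continuous.finset_sup'_apply _ fun w hw => ?_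
  have hnum : Continuous fun x : ℤ → Letter K n => (lowerGcd (x 0).residue.1 w : ℝ) :=
    (continuous_of_discreteTopology (f := fun l : Letter K n => (lowerGcd l.residue.1 w : ℝ))).comp
      (continuous_apply 0)
  have hnorm : Continuous fun x : ℤ → Letter K n => normForm (forwardEnd x) (backwardEnd x) w := by
    have := continuous_forwardEnd (K := K) (n := n)
    have := continuous_backwardEnd (K := K) (n := n)
    refine Continuous.div (by simp only [linForm]; fun_prop) (by fun_prop) fun x => ?_
    exact abs_ne_zero.2 (sub_ne_zero.2 (forwardEnd_ne_backwardEnd x))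
  refine hnum.div hnorm fun x => (normForm_pos (irrational_forwardEnd x) (irrational_backwardEnd x)
    (forwardEnd_ne_backwardEnd x) (ne_zero_of_isCoprime (mem_primitiveBox.1 hw).2)).ne'

theorem one_lt_localQuality (x : ℤ → Letter K n) : 1 < localQuality x := by
  have hgap := one_lt_forwardEnd_sub_backwardEnd x
  have hgcd : (1 : ℝ) ≤ lowerGcd (x 0).residue.1 ![1, 0] :=
    Nat.one_le_cast.2 (Nat.gcd_pos_of_pos_right _ (NeZero.pos n))
  have hunit : markedQuality x ![1, 0] =
      lowerGcd (x 0).residue.1 ![1, 0] * (forwardEnd x - backwardEnd x) := by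
    simp [markedQuality, normForm, linForm, abs_of_pos (one_pos.trans hgap)]
  refine lt_of_lt_of_le ?_ (Finset.le_sup' _ (unit_mem_primitiveBox K n))
  rw [hunit]
  exact hgap.trans_le (le_mul_of_one_le_left (one_pos.trans hgap).le hgcd)

theorem mem_primitiveBox_of_normForm_le {α β L N : ℝ} (hα : α ∈ Set.Icc 1 L) (hαβ : 1 ≤ α - β)
    (hw : IsCoprime (w 0) (w 1)) (hN : normForm α β w ≤ N) (hlin : |linForm α w| ∈ Set.Icc 1 L)
    (hR : L * (N + L + 1) ≤ R) : w ∈ primitiveBox R := by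
  obtain ⟨hα₁, hαL⟩ := hα
  obtain ⟨hlin₁, hlinL⟩ := hlin
  have hgap : 0 < α - β := one_pos.trans_le hαβ
  have hβ : |linForm β w| ≤ N * (α - β) := by
    rw [normForm, abs_of_pos hgap, div_le_iff₀ hgap] at hN
    exact (le_mul_of_one_le_left (abs_nonneg _) hlin₁).trans hN
  have hw₁ : |(w 1 : ℝ)| ≤ N + L := by
    have hdiff : w 1 * (α - β) = linForm β w - linForm α w := by simp only [linForm]; ring
    have habs := abs_sub (linForm β w) (linForm α w)
    rw [← hdiff, abs_mul, abs_of_pos hgap] at habs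
    refine le_of_mul_le_mul_right (habs.trans ?_) hgap
    nlinarith
  have hw₀ : |(w 0 : ℝ)| ≤ L * (N + L + 1) := by
    have hsum : (w 0 : ℝ) = linForm α w + α * w 1 := by simp only [linForm]; ring
    have habs := abs_add_le (linForm α w) (α * w 1)
    rw [← hsum, abs_mul, abs_of_pos (one_pos.trans_le hα₁)] at habs
    nlinarith [abs_nonneg (w 1 : ℝ)]
  refine mem_primitiveBox.2 ⟨⟨?_, ?_⟩, hw⟩ <;> rify
  · exact hw₀.trans hR
  · nlinarith [abs_nonneg (w 1 : ℝ)]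

/-- The product of the first `k` step matrices of `x`, started at `g`. -/
def frame (g : GL (Fin 2) ℤ) (x : ℤ → Letter K n) (k : ℕ) : GL (Fin 2) ℤ :=
  g * convergentMatrix (digits x) k

theorem moebius_frame_forwardEnd (g : GL (Fin 2) ℤ) (x : ℤ → Letter K n) (k : ℕ) :
    moebius (frame g x k) (forwardEnd (shift (k : ℤ) x)) = moebius g (forwardEnd x) := by
  rw [frame, moebius_mul _ _ (irrational_forwardEnd _), moebius_convergentMatrix_forwardEnd]

theorem moebius_frame_backwardEnd (g : GL (Fin 2) ℤ) (x : ℤ → Letter K n) (k : ℕ) :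
    moebius (frame g x k) (backwardEnd (shift (k : ℤ) x)) = moebius g (backwardEnd x) := by
  rw [frame, moebius_mul _ _ (irrational_backwardEnd _), moebius_convergentMatrix_backwardEnd]

theorem normForm_frame_mulVec (g : GL (Fin 2) ℤ) (x : ℤ → Letter K n) (k : ℕ) (w : Fin 2 → ℤ) :
    normForm (moebius g (forwardEnd x)) (moebius g (backwardEnd x)) ((frame g x k).1 *ᵥ w) =
      normForm (forwardEnd (shift (k : ℤ) x)) (backwardEnd (shift (k : ℤ) x)) w := by
  rw [← moebius_frame_forwardEnd g x k, ← moebius_frame_backwardEnd g x k,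
    normForm_mulVec _ (irrational_forwardEnd _) (irrational_backwardEnd _)]

theorem lowerGcd_shift (hx : IsPath Transition x) (hg : reduction n g = (x 0).residue) (k : ℕ)
    (w : Fin 2 → ℤ) :
    lowerGcd (shift (k : ℤ) x 0).residue.1 w = (((frame g x k).1 *ᵥ w) 1).gcd n := by
  rw [shift_apply, add_zero, residue_eq_of_isPath hx, ← hg, ← map_mul, lowerGcd_reduction, frame]

theorem markedQuality_shift (hx : IsPath Transition x) (hg : reduction n g = (x 0).residue) (k : ℕ)
    (w : Fin 2 → ℤ) :
    markedQuality (shift (k : ℤ) x) w = (((frame g x k).1 *ᵥ w) 1).gcd n /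
      normForm (moebius g (forwardEnd x)) (moebius g (backwardEnd x)) ((frame g x k).1 *ᵥ w) := by
  rw [markedQuality, lowerGcd_shift hx hg, normForm_frame_mulVec]

theorem exists_ge_mem_Icc_of_le_mul {e : ℕ → ℝ} {L : ℝ} (hL : 1 ≤ L) (he : 0 ≤ e 0)
    (hmul : ∀ k, e (k + 1) ≤ L * e k) {m : ℕ} (hm : L ^ m * e 0 < 1) (hexit : ∃ k, 1 ≤ e k) :
    ∃ k ≥ m, e k ∈ Set.Icc 1 L := by
  classical
  have hgrowth (k : ℕ) : e k ≤ L ^ k * e 0 := by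
    induction k with
    | zero => simp
    | succ k ih =>
      calc e (k + 1) ≤ L * e k := hmul k
        _ ≤ L * (L ^ k * e 0) := by gcongr
        _ = L ^ (k + 1) * e 0 := by ring
  have hlt : m < Nat.find hexit := by
    by_contra! hle
    refine hm.not_ge ((Nat.find_spec hexit).trans ((hgrowth _).trans ?_))
    gcongr
  obtain ⟨j, hj⟩ := Nat.exists_eq_add_one_of_ne_zero (Nat.ne_zero_of_lt hlt)
  have hprev : e j < 1 := not_le.1 (Nat.find_min hexit (hj ▸ j.lt_succ_self))
  refine ⟨Nat.find hexit, hlt.le, Nat.find_spec hexit, ?_⟩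
  rw [hj]
  exact (hmul j).trans (mul_le_of_le_one_right (zero_le_one.trans hL) hprev.le)

/- Passing from one convergent matrix to the next multiplies the linear form of `C⁻¹ v` by a factor
between `1 + 1 / (K + 1)` and `K + 1`, so it cannot jump over the range `[1, K + 1]`, in which the
bound on the norm form puts `C⁻¹ v` into the box. -/
theorem exists_ge_mem_primitiveBox (hv : IsCoprime (v 0) (v 1))
    (hN : normForm (forwardEnd x) (backwardEnd x) v ≤ n) {m : ℕ}
    (hm : (K + 1) ^ m * |linForm (forwardEnd x) v| < 1) :
    ∃ k ≥ m, (convergentMatrix (digits x) k)⁻¹.1 *ᵥ v ∈ primitiveBox (boxRadius K n) := by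
  have hirr (k : ℕ) := irrational_forwardEnd (shift (k : ℤ) x)
  have habs (k : ℕ) : |forwardEnd (shift (k : ℤ) x)| ∈ Set.Icc (1 + (K + 1 : ℝ)⁻¹) (K + 1) := by
    rw [abs_of_pos (one_pos.trans (one_lt_forwardEnd _))]
    exact forwardEnd_mem_Icc _
  set e : ℕ → ℝ := fun k =>
    |linForm (forwardEnd (shift (k : ℤ) x)) ((convergentMatrix (digits x) k)⁻¹.1 *ᵥ v)|
  have he₀ : e 0 = |linForm (forwardEnd x) v| := by
    simp only [e, convergentMatrix, inv_one, Units.val_one, one_mulVec, Nat.cast_zero, shift_zero]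
  have hstep (k : ℕ) : e (k + 1) ≤ (K + 1) * e k := by
    simp only [e, abs_linForm_inv_convergentMatrix_succ (forwardEnd_shift x) hirr]
    gcongr
    exact (habs _).2
  have hexit : ∃ k, 1 ≤ e k := by
    have hpos : 0 < |linForm (forwardEnd x) v| :=
      abs_pos.2 (linForm_ne_zero (irrational_forwardEnd x) (ne_zero_of_isCoprime hv))
    obtain ⟨k, hk⟩ := pow_unbounded_of_one_lt |linForm (forwardEnd x) v|⁻¹
      (lt_add_of_pos_right (1 : ℝ) (by positivity : 0 < (K + 1 : ℝ)⁻¹))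
    have hlow := le_abs_linForm_inv_convergentMatrix (forwardEnd_shift x) hirr (by positivity)
      (fun k => (habs k).1) v k
    rw [Nat.cast_zero, shift_zero] at hlow
    exact ⟨k, ((inv_lt_iff_one_lt_mul₀ hpos).1 hk).le.trans hlow⟩
  obtain ⟨k, hk, hek⟩ := exists_ge_mem_Icc_of_le_mul (by simp) (abs_nonneg _) hstep
    (he₀ ▸ hm) hexit
  refine ⟨k, hk, mem_primitiveBox_of_normForm_le (L := K + 1) (N := n)
    ⟨(one_lt_forwardEnd _).le, (forwardEnd_mem_Icc _).2⟩ (one_lt_forwardEnd_sub_backwardEnd _).le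
    (isCoprime_mulVec _ hv) ?_ hek (by simp only [boxRadius]; push_cast; linarith)⟩
  have hmul : (frame 1 x k).1 *ᵥ (convergentMatrix (digits x) k)⁻¹.1 *ᵥ v = v := by
    rw [frame, one_mul, mulVec_mulVec, ← Units.val_mul, mul_inv_cancel, Units.val_one, one_mulVec]
  rw [← normForm_frame_mulVec 1, hmul, moebius_one, moebius_one]
  exact hN

theorem exists_div_normForm_le_localQuality (hx : IsPath Transition x)
    (hg : reduction n g = (x 0).residue) (hv : IsCoprime (v 0) (v 1))
    (hN : normForm (moebius g (forwardEnd x)) (moebius g (backwardEnd x)) v ≤ n) {m : ℕ}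
    (hm : (K + 1) ^ m * (|g 1 0 * forwardEnd x + g 1 1| * |linForm (moebius g (forwardEnd x)) v|) <
      1) :
    ∃ k ≥ m, (v 1).gcd n / normForm (moebius g (forwardEnd x)) (moebius g (backwardEnd x)) v ≤
      localQuality (shift (k : ℤ) x) := by
  have hmul : g.1 *ᵥ g⁻¹.1 *ᵥ v = v := by
    rw [mulVec_mulVec, ← Units.val_mul, mul_inv_cancel, Units.val_one, one_mulVec]
  have hdenom := abs_ne_zero.2 (moebius_denom_ne_zero g (irrational_forwardEnd x))
  rw [← hmul, normForm_mulVec g (irrational_forwardEnd x) (irrational_backwardEnd x)] at hN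
  rw [← hmul, abs_linForm_mulVec g (irrational_forwardEnd x), mul_div_cancel₀ _ hdenom] at hm
  obtain ⟨k, hk, hbox⟩ := exists_ge_mem_primitiveBox (isCoprime_mulVec g⁻¹ hv) hN hm
  refine ⟨k, hk, ?_⟩
  have hframe : (frame g x k).1 *ᵥ (convergentMatrix (digits x) k)⁻¹.1 *ᵥ g⁻¹.1 *ᵥ v = v := by
    rw [frame, mulVec_mulVec, ← Units.val_mul, mul_inv_cancel_right, hmul]
  have := markedQuality_shift hx hg k ((convergentMatrix (digits x) k)⁻¹.1 *ᵥ g⁻¹.1 *ᵥ v)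
  rw [hframe] at this
  exact this ▸ Finset.le_sup' _ hbox

theorem abs_linForm_le {α L : ℝ} (hw₀ : |w 0| ≤ R) (hw₁ : |w 1| ≤ R) (hα : |α| ≤ L) :
    |linForm α w| ≤ R * (1 + L) := by
  rify at hw₀ hw₁
  have hmul : |α| * |(w 1 : ℝ)| ≤ L * R :=
    mul_le_mul hα hw₁ (abs_nonneg _) ((abs_nonneg _).trans hα)
  have habs := abs_sub (w 0 : ℝ) (α * w 1)
  rw [abs_mul] at habs
  rw [linForm]
  linarith

theorem exists_eq_localQuality (hx : IsPath Transition x)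
    (hg : reduction n g = (x 0).residue) (k : ℕ) : ∃ v : Fin 2 → ℤ, IsCoprime (v 0) (v 1) ∧
      (v 1).gcd n / normForm (moebius g (forwardEnd x)) (moebius g (backwardEnd x)) v =
        localQuality (shift (k : ℤ) x) ∧
      (1 + (K + 1 : ℝ)⁻¹) ^ k * |linForm (moebius g (forwardEnd x)) v| ≤
        boxRadius K n * (1 + (K + 1)) / |g 1 0 * forwardEnd x + g 1 1| := by
  obtain ⟨w, hw, hmax⟩ := Finset.exists_mem_eq_sup' ⟨_, unit_mem_primitiveBox K n⟩
    (markedQuality (shift (k : ℤ) x))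
  obtain ⟨⟨hw₀, hw₁⟩, hcop⟩ := mem_primitiveBox.1 hw
  refine ⟨(frame g x k).1 *ᵥ w, isCoprime_mulVec _ hcop, ?_, ?_⟩
  · rw [← markedQuality_shift hx hg, ← hmax, localQuality]
  · have hα : |forwardEnd (shift (k : ℤ) x)| ≤ K + 1 :=
      (abs_of_pos (one_pos.trans (one_lt_forwardEnd _))).trans_le (forwardEnd_mem_Icc _).2
    rw [frame, Units.val_mul, ← mulVec_mulVec, abs_linForm_mulVec g (irrational_forwardEnd x),
      ← mul_div_assoc]
    refine div_le_div_of_nonneg_right ?_ (abs_nonneg _)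
    have hlow := le_abs_linForm_inv_convergentMatrix (forwardEnd_shift x)
      (fun _ => irrational_forwardEnd _) (by positivity)
      (fun k => (forwardEnd_mem_Icc (shift (k : ℤ) x)).1.trans (le_abs_self _))
      ((convergentMatrix (digits x) k).1 *ᵥ w) k
    rw [mulVec_mulVec, ← Units.val_mul, inv_mul_cancel, Units.val_one, one_mulVec, Nat.cast_zero,
      shift_zero] at hlow
    exact hlow.trans (abs_linForm_le hw₀ hw₁ hα)

end LocalQuality

noncomputable section Transfer

open Function Matrix Matrix.GeneralLinearGroup SymbolicDynamics.FullShift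

variable {K n : ℕ} [NeZero n] {x : ℤ → Letter K n} {g : GL (Fin 2) ℤ} {ξ η : ℝ}

/-- The filter of rationals tending to `ξ` without being equal to it. -/
def rationalNhds (ξ : ℝ) : Filter ℚ := comap (fun q : ℚ => (q : ℝ)) (𝓝[≠] ξ)

theorem tendsto_cast_rationalNhds (ξ : ℝ) :
    Tendsto (fun q : ℚ => (q : ℝ)) (rationalNhds ξ) (𝓝 ξ) :=
  tendsto_comap.mono_right nhdsWithin_le_nhds

theorem tendsto_den_rationalNhds (hξ : Irrational ξ) :
    Tendsto (fun q : ℚ => q.den) (rationalNhds ξ) atTop := by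
  refine tendsto_atTop.2 fun N => ?_
  obtain ⟨ε, hε, hε₀⟩ := ((hξ.eventually_forall_le_dist_cast_rat_of_den_le N).filter_mono
    nhdsWithin_le_nhds |>.and (self_mem_nhdsWithin (s := Set.Ioi 0))).exists
  filter_upwards [tendsto_cast_rationalNhds ξ (Metric.ball_mem_nhds ξ hε₀)] with q hq
  by_contra! hden
  exact (hε q hden.le).not_gt (Metric.mem_ball'.1 hq)

theorem tendsto_distortion (hξη : ξ ≠ η) :
    Tendsto (distortion ξ η) (rationalNhds ξ) (𝓝 1) := by
  have h := ((tendsto_cast_rationalNhds ξ).sub_const η).abs.div_const |ξ - η|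
  rwa [div_self (abs_ne_zero.2 (sub_ne_zero.2 hξη))] at h

theorem tendsto_div_rationalNhds {ι : Type*} {l : Filter ι} {v : ι → Fin 2 → ℤ}
    (hξ : Irrational ξ) (hv : ∀ k, IsCoprime (v k 0) (v k 1))
    (hlin : Tendsto (fun k => linForm ξ (v k)) l (𝓝 0)) :
    (∀ᶠ k in l, v k 1 ≠ 0) ∧ Tendsto (fun k => (v k 0 / v k 1 : ℚ)) l (rationalNhds ξ) := by
  have hne : ∀ᶠ k in l, v k 1 ≠ 0 := by
    filter_upwards [hlin.abs.eventually_lt_const (abs_zero.trans_lt one_pos)] with k hk hk₁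
    have hunit : |v k 0| = 1 := Int.isUnit_iff_abs_eq.1 (isCoprime_zero_right.1 (hk₁ ▸ hv k))
    rw [linForm, hk₁, Int.cast_zero, mul_zero, sub_zero] at hk
    exact hk.ne (by exact_mod_cast hunit)
  refine ⟨hne, tendsto_comap_iff.2 (tendsto_nhdsWithin_iff.2 ⟨?_, .of_forall fun k => ?_⟩)⟩
  · refine tendsto_iff_dist_tendsto_zero.2 (squeeze_zero' (.of_forall fun _ => dist_nonneg) ?_
      (abs_zero (α := ℝ) ▸ hlin.abs))
    filter_upwards [hne] with k hk
    have hone : (1 : ℝ) ≤ |(v k 1 : ℝ)| := by exact_mod_cast Int.one_le_abs hk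
    rw [linForm_eq_mul ξ hk, abs_mul]
    exact le_mul_of_one_le_left (abs_nonneg _) hone
  · exact fun h => hξ ⟨_, h⟩

theorem nQuality_le_mul_distortion (hx : IsPath Transition x)
    (hg : reduction n g = (x 0).residue) {b : ℝ} {m : ℕ}
    (hm : ∀ k ≥ m, localQuality (shift (k : ℤ) x) ≤ b) {q : ℚ}
    (hq : (K + 1) ^ m * |g 1 0 * forwardEnd x + g 1 1| * n <
      q.den * distortion (moebius g (forwardEnd x)) (moebius g (backwardEnd x)) q) :
    nQuality n (moebius g (forwardEnd x)) q ≤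
      b * distortion (moebius g (forwardEnd x)) (moebius g (backwardEnd x)) q := by
  have hη := irrational_moebius g (irrational_backwardEnd x)
  have hξη := moebius_ne_moebius g (irrational_forwardEnd x) (irrational_backwardEnd x)
    (forwardEnd_ne_backwardEnd x)
  set ξ := moebius g (forwardEnd x)
  set η := moebius g (backwardEnd x)
  set v : Fin 2 → ℤ := ![q.num, q.den]
  have hv₁ : v 1 ≠ 0 := Int.natCast_ne_zero.2 q.den_nz
  have hv : IsCoprime (v 0) (v 1) := Int.isCoprime_iff_nat_coprime.2 q.reduced
  have hvq : (v 0 / v 1 : ℚ) = q := Rat.num_div_den q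
  rw [← hvq, nQuality_div_eq_mul_distortion n hη hξη hv hv₁]
  refine mul_le_mul_of_nonneg_right ?_ (distortion_pos hη hξη _).le
  rcases le_total (normForm ξ η v) n with hN | hN
  · have hnorm : normForm ξ η v = |linForm ξ v| * (q.den * distortion ξ η q) := by
      rw [normForm_eq_mul_distortion ξ η hv₁, hvq]
      simp [v]
    have hlin : (K + 1) ^ m * |g 1 0 * forwardEnd x + g 1 1| * |linForm ξ v| < 1 := by
      have hscale : 0 ≤ q.den * distortion ξ η q :=
        mul_nonneg (Nat.cast_nonneg _) (distortion_pos hη hξη q).le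
      refine lt_of_mul_lt_mul_right ?_ hscale
      rw [mul_assoc _ |linForm ξ v|, ← hnorm, one_mul]
      exact (by gcongr : _ ≤ _).trans_lt hq
    obtain ⟨k, hk, hle⟩ :=
      exists_div_normForm_le_localQuality hx hg hv hN ((mul_assoc _ _ _).symm.trans_lt hlin)
    exact hle.trans (hm k hk)
  · have hgcd : ((v 1).gcd n : ℝ) ≤ n :=
      Nat.cast_le.2 (Nat.le_of_dvd (NeZero.pos n) (Int.gcd_dvd_natAbs_right _ _))
    exact (div_le_one_of_le₀ (hgcd.trans hN) ((Nat.cast_nonneg n).trans hN)).trans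
      ((one_lt_localQuality _).le.trans (hm m le_rfl))

theorem eventually_nQuality_le (hx : IsPath Transition x) (hg : reduction n g = (x 0).residue)
    {b b' : ℝ} (hb : b < b') (hloc : ∀ᶠ k : ℕ in atTop, localQuality (shift (k : ℤ) x) ≤ b) :
    ∀ᶠ q in rationalNhds (moebius g (forwardEnd x)),
      nQuality n (moebius g (forwardEnd x)) q ≤ b' := by
  obtain ⟨m, hm⟩ := eventually_atTop.1 hloc
  have hξ := irrational_moebius g (irrational_forwardEnd x)
  have hdist := tendsto_distortion (moebius_ne_moebius g (irrational_forwardEnd x)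
    (irrational_backwardEnd x) (forwardEnd_ne_backwardEnd x))
  have hscaled :=
    (tendsto_natCast_atTop_atTop.comp (tendsto_den_rationalNhds hξ)).atTop_mul_pos one_pos hdist
  filter_upwards [hscaled.eventually_gt_atTop _,
    (hdist.const_mul b).eventually_lt_const (by rwa [mul_one])] with q hlarge hlt
  exact (nQuality_le_mul_distortion hx hg hm hlarge).trans hlt.le

theorem eventually_localQuality_le (hx : IsPath Transition x)
    (hg : reduction n g = (x 0).residue) {b b' : ℝ} (hb : b < b')
    (hqual : ∀ᶠ q in rationalNhds (moebius g (forwardEnd x)),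
      nQuality n (moebius g (forwardEnd x)) q ≤ b) :
    ∀ᶠ k : ℕ in atTop, localQuality (shift (k : ℤ) x) ≤ b' := by
  have hξ := irrational_moebius g (irrational_forwardEnd x)
  have hη := irrational_moebius g (irrational_backwardEnd x)
  have hξη := moebius_ne_moebius g (irrational_forwardEnd x) (irrational_backwardEnd x)
    (forwardEnd_ne_backwardEnd x)
  choose v hv hloc hlin using exists_eq_localQuality hx hg
  set ξ := moebius g (forwardEnd x)
  set η := moebius g (backwardEnd x)
  obtain ⟨hv₁, hvξ⟩ := tendsto_div_rationalNhds hξ hv (l := atTop) <| by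
    refine squeeze_zero_norm (fun k => (le_div_iff₀' (by positivity)).2 (hlin k))
      (tendsto_const_nhds.div_atTop (tendsto_pow_atTop_atTop_of_one_lt ?_))
    exact lt_add_of_pos_right 1 (by positivity)
  have hdist := (tendsto_distortion hξη).comp hvξ
  filter_upwards [hv₁, hvξ.eventually hqual,
    ((hdist.inv₀ one_ne_zero).const_mul b).eventually_lt_const (by rwa [inv_one, mul_one])]
    with k hk hle hlt
  rw [nQuality_div_eq_mul_distortion n hη hξη (hv k) hk, hloc] at hle
  exact ((le_mul_inv_iff₀ (distortion_pos hη hξη _)).2 hle).trans hlt.le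

theorem nApproximability_moebius_forwardEnd (hx : IsPath Transition x)
    (hg : reduction n g = (x 0).residue) :
    nApproximability n (moebius g (forwardEnd x)) = orbitLimsup localQuality x :=
  le_antisymm (limsup_coe_le_limsup_coe fun _ _ => eventually_nQuality_le hx hg)
    (limsup_coe_le_limsup_coe fun _ _ => eventually_localQuality_le hx hg)

end Transfer

noncomputable section CompleteQuotients

open Matrix Matrix.GeneralLinearGroup SymbolicDynamics.FullShift

variable {b : ℕ → ℤ} {z : ℕ → ℝ} {K n : ℕ} {ξ a : ℝ}

theorem isCoprime_convergentMatrix (b : ℕ → ℤ) (k : ℕ) :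
    IsCoprime (convergentMatrix b k 0 0) (convergentMatrix b k 1 0) := by
  have h := isCoprime_mulVec (convergentMatrix b k) (w := Pi.single 0 1)
    (by simp [isCoprime_one_left])
  rwa [mulVec_single_one] at h

theorem abs_linForm_convergentMatrix_col (hz : ∀ k, z k = b k + (z (k + 1))⁻¹)
    (hirr : ∀ k, Irrational (z k)) (k : ℕ) :
    |linForm (z 0) ((convergentMatrix b k).1.col 0)| =
      |convergentMatrix b k 1 0 * z k + convergentMatrix b k 1 1|⁻¹ := by
  have h := abs_linForm_mulVec (convergentMatrix b k) (hirr k) (Pi.single 0 1)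
  rw [moebius_convergentMatrix hz hirr, mulVec_single_one] at h
  simpa [linForm] using h

theorem mul_le_abs_convergentMatrix_denom (hb : ∀ k, 1 ≤ b (k + 1)) (k : ℕ) :
    convergentMatrix b (k + 1) 1 0 * z (k + 1) ≤
      |convergentMatrix b (k + 1) 1 0 * z (k + 1) + convergentMatrix b (k + 1) 1 1| := by
  have hnonneg : (0 : ℝ) ≤ convergentMatrix b k 1 0 := by
    exact_mod_cast (Int.natCast_nonneg _).trans (fib_le_convergentMatrix hb k)
  rw [convergentMatrix_succ_apply_one]
  exact (le_add_of_nonneg_right hnonneg).trans (le_abs_self _)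

theorem tendsto_linForm_convergentMatrix_col (hz : ∀ k, z k = b k + (z (k + 1))⁻¹)
    (hirr : ∀ k, Irrational (z k)) (hb : ∀ k, 1 ≤ b (k + 1)) (h₁ : ∀ k, 1 < z (k + 1)) :
    Tendsto (fun k => linForm (z 0) ((convergentMatrix b (k + 1)).1.col 0)) atTop (𝓝 0) := by
  rw [tendsto_zero_iff_abs_tendsto_zero]
  have hdenom : Tendsto (fun k => |convergentMatrix b (k + 1) 1 0 * z (k + 1) +
      convergentMatrix b (k + 1) 1 1|) atTop atTop := by
    refine tendsto_atTop_mono (fun k => ?_) (tendsto_natCast_atTop_atTop (R := ℝ))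
    have hfib : ((k + 1).fib : ℝ) ≤ convergentMatrix b (k + 1) 1 0 := by
      exact_mod_cast fib_le_convergentMatrix hb (k + 1)
    have hk : (k : ℝ) ≤ (k + 1).fib := by
      exact_mod_cast Nat.le_of_succ_le_succ (Nat.le_fib_add_one (k + 1))
    refine le_trans ?_ (mul_le_abs_convergentMatrix_denom hb k)
    exact (hk.trans hfib).trans (le_mul_of_one_le_right ((Nat.cast_nonneg _).trans hfib) (h₁ k).le)
  exact hdenom.inv_tendsto_atTop.congr fun k => (abs_linForm_convergentMatrix_col hz hirr _).symm

theorem le_nQuality_convergent (n : ℕ) (hz : ∀ k, z k = b k + (z (k + 1))⁻¹)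
    (hirr : ∀ k, Irrational (z k)) (hb : ∀ k, 1 ≤ b (k + 1)) (k : ℕ) :
    z (k + 1) ≤ nQuality n (z 0)
      (convergentMatrix b (k + 1) 0 0 / convergentMatrix b (k + 1) 1 0) := by
  have hfib : 0 < convergentMatrix b (k + 1) 1 0 :=
    (Int.natCast_pos.2 (Nat.fib_pos.2 k.succ_pos)).trans_le (fib_le_convergentMatrix hb (k + 1))
  have hgcd : (1 : ℝ) ≤ (convergentMatrix b (k + 1) 1 0).gcd n :=
    Nat.one_le_cast.2 (Int.gcd_pos_of_ne_zero_left _ hfib.ne')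
  have hquality := nQuality_div n (z 0) (w := (convergentMatrix b (k + 1)).1.col 0)
    (isCoprime_convergentMatrix b (k + 1)) hfib.ne'
  rw [abs_linForm_convergentMatrix_col hz hirr] at hquality
  simp only [col_apply] at hquality
  have hpos : (0 : ℝ) < convergentMatrix b (k + 1) 1 0 := Int.cast_pos.2 hfib
  rw [hquality, abs_of_pos hpos, ← div_eq_mul_inv, div_div_eq_mul_div, le_div_iff₀ hpos, mul_comm]
  exact (mul_le_abs_convergentMatrix_denom hb k).trans
    (le_mul_of_one_le_left (abs_nonneg _) hgcd)

/-- The complete quotients of the continued fraction of `ξ`. -/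
def completeQuotient (ξ : ℝ) : ℕ → ℝ
  | 0 => ξ
  | k + 1 => (Int.fract (completeQuotient ξ k))⁻¹

/-- The partial quotients of the continued fraction of `ξ`. -/
def partialQuotient (ξ : ℝ) (k : ℕ) : ℤ := ⌊completeQuotient ξ k⌋

theorem completeQuotient_eq (ξ : ℝ) (k : ℕ) :
    completeQuotient ξ k = partialQuotient ξ k + (completeQuotient ξ (k + 1))⁻¹ := by
  rw [completeQuotient, inv_inv, partialQuotient, Int.floor_add_fract]

theorem irrational_completeQuotient (hξ : Irrational ξ) (k : ℕ) :
    Irrational (completeQuotient ξ k) := by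
  induction k with
  | zero => exact hξ
  | succ k ih => exact (ih.sub_intCast _).inv

theorem one_lt_completeQuotient_succ (hξ : Irrational ξ) (k : ℕ) :
    1 < completeQuotient ξ (k + 1) :=
  one_lt_inv_iff₀.2 ⟨(Int.fract_nonneg _).lt_of_ne'
    ((irrational_completeQuotient hξ k).sub_intCast _).ne_zero, Int.fract_lt_one _⟩

theorem one_le_partialQuotient_succ (hξ : Irrational ξ) (k : ℕ) :
    1 ≤ partialQuotient ξ (k + 1) :=
  Int.le_floor.2 (by exact_mod_cast (one_lt_completeQuotient_succ hξ k).le)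

theorem eventually_completeQuotient_le (hξ : Irrational ξ)
    (ha : ∀ᶠ q in rationalNhds ξ, nQuality n ξ q ≤ a) :
    ∀ᶠ k in atTop, completeQuotient ξ k ≤ a := by
  have hz := completeQuotient_eq ξ
  have hirr := irrational_completeQuotient hξ
  have hb := one_le_partialQuotient_succ hξ
  have h₁ := one_lt_completeQuotient_succ hξ
  have hconv := (tendsto_div_rationalNhds hξ (fun k => isCoprime_convergentMatrix _ (k + 1))
    (tendsto_linForm_convergentMatrix_col hz hirr hb h₁)).2
  rw [← map_add_atTop_eq_nat 1, eventually_map]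
  filter_upwards [hconv.eventually ha] with k hk
  exact (le_nQuality_convergent n hz hirr hb k).trans hk

theorem forwardEnd_eq [NeZero n] {x : ℤ → Letter K n}
    (hz : ∀ k, z k = digits x k + (z (k + 1))⁻¹) (hbd : ∀ k, z k ∈ Set.Icc 1 (K + 1 : ℝ)) :
    forwardEnd x = z 0 := by
  have h := eq_of_eq_add_inv (forwardEnd_shift x) hz (lt_add_of_pos_right 1 (by positivity))
    (fun k => forwardEnd_mem_Icc _) fun k => ⟨?_, (hbd k).2⟩
  · rwa [Nat.cast_zero, shift_zero] at h
  · have hdigit : (1 : ℝ) ≤ digits x k := by exact_mod_cast (x k).digit.2.1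
    rw [hz k]
    exact add_le_add hdigit (inv_anti₀ (one_pos.trans_le (hbd _).1) (hbd _).2)

theorem exists_isPath_moebius_forwardEnd_eq [NeZero n] (hξ : Irrational ξ)
    (hK : ∀ᶠ k in atTop, completeQuotient ξ k ≤ K) : ∃ (x : ℤ → Letter K n) (g : GL (Fin 2) ℤ),
      IsPath Transition x ∧ reduction n g = (x 0).residue ∧ moebius g (forwardEnd x) = ξ := by
  obtain ⟨m, hm⟩ := eventually_atTop.1 hK
  let digit (k : ℕ) : Set.Icc (1 : ℤ) K := ⟨partialQuotient ξ (m + k + 1),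
    one_le_partialQuotient_succ hξ _, by
      exact_mod_cast (Int.floor_le _).trans (hm (m + k + 1) (by lia))⟩
  let g (k : ℕ) : GL (Fin 2) ℤ := convergentMatrix (partialQuotient ξ) (m + k + 1)
  let x (i : ℤ) : Letter K n := ⟨digit i.toNat, reduction n (g i.toNat), g i.toNat, rfl⟩
  have hend : forwardEnd x = completeQuotient ξ (m + 0 + 1) :=
    forwardEnd_eq (z := fun k => completeQuotient ξ (m + k + 1)) (fun k => completeQuotient_eq ξ _)
      fun k => ⟨(one_lt_completeQuotient_succ hξ _).le, (hm _ (by lia)).trans (by simp)⟩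
  refine ⟨x, g 0, fun k => ?_, rfl, ?_⟩
  · exact map_mul (reduction n) _ _
  · rw [hend]
    exact moebius_convergentMatrix (completeQuotient_eq ξ) (irrational_completeQuotient hξ) _

end CompleteQuotients

section Spectrum

open Function Matrix Matrix.GeneralLinearGroup SymbolicDynamics.FullShift

theorem nLagrangeSpectrum_inter_Iio_subset_pathSpectrum (K n : ℕ) [NeZero n] :
    nLagrangeSpectrum n ∩ Set.Iio (K : ℝ) ⊆
      pathSpectrum (Transition (K := K) (n := n)) localQuality := by
  rintro a ⟨⟨ξ, hξ, hξa⟩, haK⟩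
  have hquality : ∀ᶠ q in rationalNhds ξ, nQuality n ξ q ≤ K := by
    have h := (limsup_coe_eq_coe_iff.1 hξa (K - a) (sub_pos.2 haK)).1
    rwa [add_sub_cancel] at h
  obtain ⟨x, g, hx, hg, hgξ⟩ :=
    exists_isPath_moebius_forwardEnd_eq (n := n) hξ (eventually_completeQuotient_le hξ hquality)
  rw [← hgξ, nApproximability_moebius_forwardEnd hx hg] at hξa
  exact ⟨x, hx, hξa⟩

theorem pathSpectrum_subset_nLagrangeSpectrum (K n : ℕ) [NeZero n] :
    pathSpectrum (Transition (K := K) (n := n)) localQuality ⊆ nLagrangeSpectrum n := by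
  rintro a ⟨x, hx, ha⟩
  obtain ⟨g, hg⟩ := (x 0).residue.2
  exact ⟨moebius g (forwardEnd x), irrational_moebius g (irrational_forwardEnd x),
    (nApproximability_moebius_forwardEnd hx hg).trans ha⟩

theorem isQuadraticIrrational_moebius_forwardEnd {K n : ℕ} [NeZero n] (g : GL (Fin 2) ℤ)
    {x : ℤ → Letter K n} {p : ℕ} (hp : 0 < p) (hx : Periodic x p) :
    IsQuadraticIrrational (moebius g (forwardEnd x)) := by
  have hirr := irrational_forwardEnd x
  set C := convergentMatrix (digits x) p
  have hfix : moebius C (forwardEnd x) = forwardEnd x := by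
    have h := moebius_convergentMatrix_forwardEnd x p
    have hshift : shift (p : ℤ) x = x := funext fun i => by rw [shift_apply, add_comm, hx]
    rwa [hshift] at h
  have hC : 0 < C 1 0 := (Int.natCast_pos.2 (Nat.fib_pos.2 hp)).trans_le
    (fib_le_convergentMatrix (fun k => (x _).digit.2.1) p)
  refine isQuadraticIrrational_of_moebius_eq_self (M := g * C * g⁻¹) (irrational_moebius g hirr)
    ?_ (fun h => ?_) fun h => ?_
  · rw [← moebius_mul _ _ hirr, inv_mul_cancel_right, moebius_mul _ _ hirr, hfix]
  · rw [mul_inv_eq_one, mul_eq_left] at h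
    simp [h] at hC
  · rw [mul_inv_eq_iff_eq_mul, neg_mul, one_mul, ← mul_neg_one, mul_right_inj] at h
    simp [h] at hC

theorem periodicSpectrum_subset_quadraticApproximabilities (K n : ℕ) [NeZero n] :
    periodicSpectrum (Transition (K := K) (n := n)) localQuality ⊆
      quadraticApproximabilities n := by
  rintro a ⟨x, ⟨p, hp, hper⟩, hx, ha⟩
  lift p to ℕ using hp.le
  obtain ⟨g, hg⟩ := (x 0).residue.2
  exact ⟨moebius g (forwardEnd x),
    isQuadraticIrrational_moebius_forwardEnd g (Int.natCast_pos.1 hp) hper,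
    (nApproximability_moebius_forwardEnd hx hg).trans ha⟩

theorem quadraticApproximabilities_subset_nLagrangeSpectrum (n : ℕ) :
    quadraticApproximabilities n ⊆ nLagrangeSpectrum n :=
  fun _ ⟨ξ, hξ, ha⟩ => ⟨ξ, hξ.1, ha⟩

theorem nLagrangeSpectrum_subset_closure (n : ℕ) [NeZero n] :
    nLagrangeSpectrum n ⊆ closure (quadraticApproximabilities n) := by
  intro a ha
  obtain ⟨K, haK⟩ := exists_nat_gt a
  have hpath := nLagrangeSpectrum_inter_Iio_subset_pathSpectrum K n ⟨ha, haK⟩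
  rw [pathSpectrum_eq_closure continuous_localQuality] at hpath
  exact closure_mono (periodicSpectrum_subset_quadraticApproximabilities K n) hpath

theorem isClosed_nLagrangeSpectrum (n : ℕ) [NeZero n] : IsClosed (nLagrangeSpectrum n) := by
  refine isClosed_of_closure_subset fun a ha => ?_
  obtain ⟨K, haK⟩ := exists_nat_gt a
  have hclosed : IsClosed (pathSpectrum (Transition (K := K) (n := n)) localQuality) := by
    rw [pathSpectrum_eq_closure continuous_localQuality]
    exact isClosed_closure
  have hbelow : a ∈ closure (nLagrangeSpectrum n ∩ Set.Iio (K : ℝ)) :=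
    isOpen_Iio.closure_inter ⟨ha, haK⟩
  exact pathSpectrum_subset_nLagrangeSpectrum K n
    (closure_minimal (nLagrangeSpectrum_inter_Iio_subset_pathSpectrum K n) hclosed hbelow)

end Spectrum

theorem mainTheorem4 (n : ℕ) (hn : 1 ≤ n) :
    IsClosed (nLagrangeSpectrum n) ∧
      nLagrangeSpectrum n = closure (quadraticApproximabilities n) := by
  have : NeZero n := ⟨Nat.one_le_iff_ne_zero.1 hn⟩
  have hclosed := isClosed_nLagrangeSpectrum n
  exact ⟨hclosed, (nLagrangeSpectrum_subset_closure n).antisymm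
    (closure_minimal (quadraticApproximabilities_subset_nLagrangeSpectrum n) hclosed)⟩
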